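/- Let $l>0$, let $D=\mathrm{diag}\{d_1,\dots,d_p\}$ with $d_1,\dots,d_p>0$, let $\Theta_1,\Theta_2$ be complex $n\times p$ matrices and let $\beta$ be a complex $n\times n$ matrix such that $$\beta^*-\beta=i(\Theta_2-\Theta_1)D^{-1}(\Theta_2-\Theta_1)^*.$$ Put $k(x)=\{k_{ij}(x)\}_{i,j=1}^p=\Theta_2^*e^{ix\beta^*}\Theta_1$ and $k(-x)=k(x)^*$ for $x>0$. Then the formula $$(Sf)_i(x)=f_i(x)+\int_0^l\sum_{j=1}^p k_{ij}(d_ix-d_jt)f_j(t)\,dt\qquad(1\le i\le p)$$ defines a bounded operator $S$ on $L^2_p(0,l)=L^2((0,l);\mathbb C^p)$ which is positive, that is, $S=S^*$ and $(Sf,f)_{L^2}>0$ for all $f\neq0$, and which is boundedly invertible. Moreover, the function $\varphi(\lambda)=\frac i2D+\Theta_1^*(\beta-\lambda I_n)^{-1}\Theta_2$ has a Herglotz representation $$\varphi(\lambda)=\nu+\int_{-\infty}^{\infty}\Big(\frac1{z-\lambda}-\frac z{1+z^2}\Big)d\tau(z)\qquad(\operatorname{Im}\lambda>0)$$ with a $p\times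 p$ matrix $\nu=\nu^*$ and a nonnegative $p\times p$ matrix measure $\tau$ on $\mathbb R$ such that $\int_{-\infty}^\infty(1+z^2)^{-1}d\tau(z)$ converges, and $$S=\int_{-\infty}^{\infty}(I-zA)^{-1}\Phi_2\,d\tau(z)\,\Phi_2^*(I-zA^*)^{-1},\qquad A=iD\int_0^x\cdot\,dt,\quad \Phi_2g\equiv g\ (g\in\mathbb C^p),$$ the integral being weakly convergent. Explicitly, $\Phi_2^*(I-zA^*)^{-1}f=\widehat f(z):=\int_0^le^{-izxD}f(x)\,dx$, and for all $f,g\in L^2_p(0,l)$ $$(Sf,g)_{L^2}=\int_{-\infty}^{\infty}\widehat g(z)^*\,d\tau(z)\,\widehat f(z),$$ where the integral converges absolutely. -/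

import Mathlib

open MeasureTheory
open scoped Matrix

noncomputable section

open scoped ComplexOrder

namespace DDifference

/-- The space `L²_p(0,l)` of square integrable `ℂ^p`-valued functions on the interval `(0,l)`. -/
abbrev L2 (p : ℕ) (l : ℝ) : Type :=
  Lp (EuclideanSpace ℂ (Fin p)) 2 (volume.restrict (Set.Ioo (0 : ℝ) l))

/-- The diagonal matrix `D = diag {d_1, …, d_p}`. -/
def diagD {p : ℕ} (d : Fin p → ℝ) : Matrix (Fin p) (Fin p) ℂ :=
  Matrix.diagonal fun i => (d i : ℂ)

/-- The matrix function `k(x) = Θ₂^* e^{i x β^*} Θ₁` for `x > 0`, `k(-x) = k(x)^*`.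
The value at `x = 0` plays no role: it only affects the kernel on a null set. -/
def kernel {n p : ℕ} (β : Matrix (Fin n) (Fin n) ℂ) (Θ₁ Θ₂ : Matrix (Fin n) (Fin p) ℂ)
    (x : ℝ) : Matrix (Fin p) (Fin p) ℂ :=
  if 0 < x then Θ₂ᴴ * NormedSpace.exp ((Complex.I * (x : ℂ)) • βᴴ) * Θ₁
  else (Θ₂ᴴ * NormedSpace.exp ((Complex.I * ((-x : ℝ) : ℂ)) • βᴴ) * Θ₁)ᴴ

/-- The bounded operator `S` on `L²_p(0,l)` is the operator with `D`-difference kernel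
`S = I + ∫_0^l {k_{ij}(d_i x - d_j t)} · dt`.  There is at most one such bounded operator. -/
def IsDDifferenceOperator {p : ℕ} (d : Fin p → ℝ) (l : ℝ)
    (k : ℝ → Matrix (Fin p) (Fin p) ℂ) (S : L2 p l →L[ℂ] L2 p l) : Prop :=
  ∀ f : L2 p l, ∀ᵐ x ∂(volume.restrict (Set.Ioo (0 : ℝ) l)), ∀ i : Fin p,
    S f x i = f x i +
      ∫ t in Set.Ioo (0 : ℝ) l, ∑ j : Fin p, k (d i * x - d j * t) i j * f t j

/-- The rational matrix function `φ(w) = (i/2) D + Θ₁^* (β - w)⁻¹ Θ₂`. -/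
def phi {n p : ℕ} (d : Fin p → ℝ) (β : Matrix (Fin n) (Fin n) ℂ)
    (Θ₁ Θ₂ : Matrix (Fin n) (Fin p) ℂ) (w : ℂ) : Matrix (Fin p) (Fin p) ℂ :=
  (Complex.I / 2) • diagD d + Θ₁ᴴ * (β - w • (1 : Matrix (Fin n) (Fin n) ℂ))⁻¹ * Θ₂

/-- A nonnegative `p × p` matrix measure `dτ = density · d base` on the real line, given by a
scalar measure and a measurable density with positive semidefinite values. -/
structure MatrixMeasure (p : ℕ) where
  base : Measure ℝ
  density : ℝ → Matrix (Fin p) (Fin p) ℂ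
  measurable_density : ∀ i j, Measurable fun z => density z i j
  posSemidef_density : ∀ z, (density z).PosSemidef

/-- `τ` is the measure in the Herglotz representation
`φ(w) = ν + ∫ (1/(z - w) - z/(1 + z²)) dτ(z)`, `ν = ν^*`, of `φ` on the upper half-plane, where
`∫ (1 + z²)⁻¹ dτ(z)` converges.  Such a measure is determined by `φ`. -/
def IsHerglotzMeasure {p : ℕ} (φ : ℂ → Matrix (Fin p) (Fin p) ℂ) (τ : MatrixMeasure p) : Prop :=
  (∀ i j, Integrable (fun z : ℝ => (1 + (z : ℂ) ^ 2)⁻¹ * τ.density z i j) τ.base) ∧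
  ∃ ν : Matrix (Fin p) (Fin p) ℂ, ν.IsHermitian ∧ ∀ w : ℂ, 0 < w.im → ∀ i j,
    φ w i j = ν i j +
      ∫ z : ℝ, (((z : ℂ) - w)⁻¹ - (z : ℂ) / (1 + (z : ℂ) ^ 2)) * τ.density z i j ∂τ.base

/-- `Φ₂^* (I - zA^*)⁻¹ f = ∫_0^l e^{-izxD} f(x) dx ∈ ℂ^p`, where `A = iD ∫_0^x · dt` and
`Φ₂ g ≡ g`.  Its adjoint is `(I - zA)⁻¹ Φ₂ : g ↦ e^{izxD} g`. -/
def transform {p : ℕ} (d : Fin p → ℝ) (l : ℝ) (f : L2 p l) (z : ℝ) : Fin p → ℂ :=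
  fun i => ∫ x in Set.Ioo (0 : ℝ) l,
    Complex.exp (-(Complex.I * (z : ℂ) * (x : ℂ) * (d i : ℂ))) * f x i

/-- `S = ∫ (I - zA)⁻¹ Φ₂ dτ(z) Φ₂^* (I - zA^*)⁻¹`, the integral being weakly convergent. -/
def IsSpectralIntegral {p : ℕ} (d : Fin p → ℝ) (l : ℝ) (τ : MatrixMeasure p)
    (S : L2 p l →L[ℂ] L2 p l) : Prop :=
  ∀ f g : L2 p l,
    Integrable (fun z : ℝ =>
      star (transform d l g z) ⬝ᵥ (τ.density z *ᵥ transform d l f z)) τ.base ∧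
    inner ℂ g (S f) =
      ∫ z : ℝ, star (transform d l g z) ⬝ᵥ (τ.density z *ᵥ transform d l f z) ∂τ.base

end DDifference

end

/-! With Δ = Θ₂ - Θ₁ the hypothesis says iβ* + (iβ*)* = -ΔD⁻¹Δ* ≤ 0, so iβ* is dissipative. An
eigenvector of β with a real eigenvalue lies in the kernel of Δ*, where β and β* agree. Such vectors
therefore reduce β, and a maximal orthonormal family u_k of them, with eigenvalues ev_k, can be
split off (`exists_stable_realization`). If P is the projection onto their span, C = iβ* - P is
stable and acts as iβ* on the range of 1 - P. The kernel becomes a decaying part X₂*e^{sC}X₁ plus a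
sum of e^{is ev_k} a_k a_k*, where a_k = Θ₂*u_k = Θ₁*u_k.

For H(z) = X₂*(iz - C)⁻¹X₁, the Fourier transform of the decaying part cut off to s > 0, one has D +
H + H* = G*D⁻¹G (`density_factorization`). So τ, with density (2π)⁻¹G*D⁻¹G and atoms a_k a_k* at
ev_k, is nonnegative. Rescaling the i-th variable by d_i turns the D-difference kernel into
convolutions, and Plancherel gives the spectral form of S (`inner_eq_spectral`). Plancherel against
Cauchy kernels shows that the same τ is the Herglotz measure of φ
(`isHerglotzMeasure_spectralMeasure`).

Nonnegativity of τ does not yet give invertibility of S, because G may be singular at some real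
points. But det G has finitely many real zeros and G tends to D at infinity, so a weighted norm of
G⁻¹ is bounded off a set E of arbitrarily small measure. As f lives on a bounded interval, its
transform is pointwise at most a constant times ‖f‖, so E carries at most half of the Plancherel
mass 2π‖f‖². Hence (Sf,f) ≥ c‖f‖² with c > 0 (`exists_coercive`), which yields strict positivity and
bounded invertibility. -/

noncomputable section

open scoped ComplexOrder

namespace DDifference

open Filter Topology ComplexConjugate

/-! ### Plancherel and Parseval formulas for the Fourier integral -/

section Fourier

open FourierTransform

/-- The `L²` Fourier transform of an integrable square integrable function is given by the
Fourier integral. -/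
lemma fourier_toLp_ae_eq {u : ℝ → ℂ} (h1 : Integrable u) (h2 : MemLp u 2) :
    (𝓕 (h2.toLp u) : Lp (α := ℝ) ℂ 2 volume) =ᵐ[volume] (𝓕 u : ℝ → ℂ) := by
  have hc : Continuous (𝓕 u : ℝ → ℂ) :=
    VectorFourier.fourierIntegral_continuous Real.continuous_fourierChar
      (by exact continuous_inner) h1
  -- Smooth compactly supported test functions are Schwartz functions. Against them the L² transform
  -- acts as a tempered distribution, which moves the transform onto the test function; Fubini moves
  -- it back onto `u`.
  refine ae_eq_of_integral_contDiff_smul_eq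
    ((Lp.memLp _).locallyIntegrable (by norm_num)) hc.locallyIntegrable fun g hg hgs => ?_
  have hg' : ContDiff ℝ (⊤ : ℕ∞) fun x => (g x : ℂ) := Complex.ofRealCLM.contDiff.comp hg
  have hgs' : HasCompactSupport fun x => (g x : ℂ) := hgs.comp_left Complex.ofReal_zero
  set G : SchwartzMap ℝ ℂ := hgs'.toSchwartzMap hg'
  have hG : ∀ x, G x = (g x : ℂ) := fun x => rfl
  have key := congrArg (fun T => T G) (Lp.fourier_toTemperedDistribution_eq (h2.toLp u))
  simp only [TemperedDistribution.fourier_apply, Lp.toTemperedDistribution_apply] at key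
  have e1 : ∫ x, g x • (𝓕 (h2.toLp u) : Lp (α := ℝ) ℂ 2 volume) x =
      ∫ x, G x • (𝓕 (h2.toLp u) : Lp (α := ℝ) ℂ 2 volume) x := by
    congr 1
  have e2 : ∫ x, g x • (𝓕 u : ℝ → ℂ) x = ∫ x, G x • (𝓕 u : ℝ → ℂ) x := by
    congr 1
  rw [e1, e2, ← key]
  have e3 : ∫ x, (𝓕 G) x • (h2.toLp u) x = ∫ x, (𝓕 G) x • u x := by
    apply integral_congr_ae
    filter_upwards [h2.coeFn_toLp] with x hx
    rw [hx]
  rw [e3]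
  have := VectorFourier.integral_fourierIntegral_smul_eq_flip (μ := volume) (ν := volume)
    (L := innerₗ ℝ) (f := (G : ℝ → ℂ)) (g := u) Real.continuous_fourierChar
    continuous_inner G.integrable h1
  simp only [flip_innerₗ] at this
  exact this

/-- The Fourier transform `∫ e^{-izs} u(s) ds`. -/
def ft (u : ℝ → ℂ) (z : ℝ) : ℂ := ∫ s : ℝ, Complex.exp (-(Complex.I * z * s)) * u s

lemma ft_eq (u : ℝ → ℂ) (z : ℝ) : ft u z = 𝓕 u ((2 * Real.pi)⁻¹ * z) := by
  rw [Real.fourier_eq', ft]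
  congr 1
  ext s
  rw [smul_eq_mul]
  congr 2
  have : (Real.pi : ℂ) ≠ 0 := by exact_mod_cast Real.pi_ne_zero
  simp
  field_simp

lemma continuous_ft {u : ℝ → ℂ} (hu : Integrable u) : Continuous (ft u) := by
  have hc : Continuous (𝓕 u : ℝ → ℂ) :=
    VectorFourier.fourierIntegral_continuous Real.continuous_fourierChar
      (by exact continuous_inner) hu
  have : ft u = fun z => 𝓕 u ((2 * Real.pi)⁻¹ * z) := funext (ft_eq u)
  rw [this]
  fun_prop

lemma norm_exp_neg_I (z s : ℝ) : ‖Complex.exp (-(Complex.I * z * s))‖ = 1 := by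
  rw [Complex.norm_exp]; simp

lemma norm_ft_le (u : ℝ → ℂ) (z : ℝ) : ‖ft u z‖ ≤ ∫ s, ‖u s‖ := by
  refine (norm_integral_le_integral_norm _).trans (le_of_eq ?_)
  simp [norm_exp_neg_I, -Complex.norm_mul, norm_mul]

/-- Riemann–Lebesgue. For a non-integrable `u` the integral takes its default value 0, so no
integrability is required. -/
lemma tendsto_ft (u : ℝ → ℂ) : Tendsto (ft u) (cocompact ℝ) (𝓝 0) := by
  have h := Real.zero_at_infty_fourier u
  have h2 : Tendsto (fun z : ℝ => (2 * Real.pi)⁻¹ * z) (cocompact ℝ) (cocompact ℝ) :=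
    (Homeomorph.mulLeft₀ ((2 * Real.pi)⁻¹) (by positivity)).isClosedEmbedding.tendsto_cocompact
  have : ft u = fun z => 𝓕 u ((2 * Real.pi)⁻¹ * z) := funext (ft_eq u)
  rw [this]
  exact h.comp h2

/-- Plancherel's theorem for functions in `L¹ ∩ L²`. -/
lemma plancherel {u v : ℝ → ℂ} (hu : Integrable u) (hu2 : MemLp u 2) (hv : Integrable v)
    (hv2 : MemLp v 2) :
    Integrable (fun z => conj (ft u z) * ft v z) ∧
    ∫ z, conj (ft u z) * ft v z = 2 * Real.pi * ∫ s, conj (u s) * v s := by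
  have aeu := fourier_toLp_ae_eq hu hu2
  have aev := fourier_toLp_ae_eq hv hv2
  have key := Lp.inner_fourier_eq (hu2.toLp u) (hv2.toLp v)
  have hint := L2.integrable_inner (𝕜 := ℂ) (𝓕 (hu2.toLp u) : Lp (α := ℝ) ℂ 2 volume)
    (𝓕 (hv2.toLp v) : Lp (α := ℝ) ℂ 2 volume)
  rw [L2.inner_def, L2.inner_def] at key
  have e1 : (fun a => inner ℂ ((𝓕 (hu2.toLp u) : Lp (α := ℝ) ℂ 2 volume) a)
      ((𝓕 (hv2.toLp v) : Lp (α := ℝ) ℂ 2 volume) a)) =ᵐ[volume]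
      fun a => conj (𝓕 u a) * 𝓕 v a := by
    filter_upwards [aeu, aev] with a ha hb
    rw [ha, hb, RCLike.inner_apply, mul_comm]
  have e2 : (fun a => inner ℂ ((hu2.toLp u) a) ((hv2.toLp v) a)) =ᵐ[volume]
      fun a => conj (u a) * v a := by
    filter_upwards [hu2.coeFn_toLp, hv2.coeFn_toLp] with a ha hb
    rw [ha, hb, RCLike.inner_apply, mul_comm]
  rw [integral_congr_ae e1, integral_congr_ae e2] at key
  have hint' := (integrable_congr e1).1 hint
  have hpi : (0:ℝ) < (2 * Real.pi)⁻¹ := by positivity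
  simp only [ft_eq]
  refine ⟨hint'.comp_mul_left' hpi.ne', ?_⟩
  rw [Measure.integral_comp_mul_left (fun z => conj (𝓕 u z) * 𝓕 v z), key, inv_inv,
    abs_of_pos (by positivity)]
  simp

open scoped Convolution in
lemma ft_convolution {u v : ℝ → ℂ} (hu : Integrable u) (hv : Integrable v) (z : ℝ) :
    ft (fun y => ∫ t, u (y - t) * v t) z = ft u z * ft v z := by
  have h := Real.fourier_mul_convolution_eq hv hu ((2 * Real.pi)⁻¹ * z)
  rw [ft_eq, ft_eq, ft_eq, mul_comm (𝓕 u _), ← h]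
  refine congrArg (fun w : ℝ → ℂ => 𝓕 w ((2 * Real.pi)⁻¹ * z)) (funext fun y => ?_)
  simp only [convolution, ContinuousLinearMap.mul_apply']
  simp_rw [mul_comm]

lemma integrable_convolution {u v : ℝ → ℂ} (hu : Integrable u) (hv : Integrable v) :
    Integrable (fun y => ∫ t, u (y - t) * v t) := by
  have h := hv.integrable_convolution (ContinuousLinearMap.mul ℂ ℂ) hu
  refine h.congr (ae_of_all _ fun y => ?_)
  simp only [convolution, ContinuousLinearMap.mul_apply']
  simp_rw [mul_comm]

/-- The inclusion L¹ ∩ L^∞ ⊆ L² admits bounded integrable kernels to Plancherel's theorem. -/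
lemma memLp_two_of_bound {u : ℝ → ℂ} (hu : Integrable u) {C : ℝ} (hC : ∀ s, ‖u s‖ ≤ C) :
    MemLp u 2 := by
  rw [memLp_two_iff_integrable_sq_norm hu.1]
  refine (hu.norm.const_mul C).mono' (hu.1.norm.pow 2) (ae_of_all _ fun s => ?_)
  rw [Real.norm_of_nonneg (by positivity), pow_two]
  exact mul_le_mul_of_nonneg_right (hC s) (norm_nonneg _)

/-- The Parseval formula for a convolution with a bounded integrable function. -/
lemma parseval_convolution {f g h : ℝ → ℂ} (hf : Integrable f) (hg : Integrable g)
    (hg2 : MemLp g 2) (hh : Integrable h) {C : ℝ} (hC : ∀ s, ‖h s‖ ≤ C) :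
    Integrable (fun z => conj (ft g z) * (ft h z * ft f z)) ∧
    ∫ z, conj (ft g z) * (ft h z * ft f z) =
      2 * Real.pi * ∫ y, conj (g y) * ∫ t, h (y - t) * f t := by
  have hi := integrable_convolution hh hf
  -- Boundedness of `h` makes the convolution bounded, hence square integrable, without an L²
  -- assumption on `f`.
  have hb : ∀ y, ‖∫ t, h (y - t) * f t‖ ≤ C * ∫ t, ‖f t‖ := fun y => by
    rw [← integral_const_mul]
    refine norm_integral_le_of_norm_le (hf.norm.const_mul C) (ae_of_all _ fun t => ?_)
    rw [norm_mul]
    exact mul_le_mul_of_nonneg_right (hC _) (norm_nonneg _)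
  have := plancherel hg hg2 hi (memLp_two_of_bound hi hb)
  simpa only [ft_convolution hh hf] using this

end Fourier

/-! ### Exponential decay of stable matrix semigroups -/

section MatrixExponential

variable {n : ℕ}

/-- A matrix is stable if all its eigenvalues have negative real part. -/
def IsStable (C : Matrix (Fin n) (Fin n) ℂ) : Prop :=
  ∀ (μ : ℂ) (v : Fin n → ℂ), v ≠ 0 → C *ᵥ v = μ • v → μ.re < 0

open scoped Matrix.Norms.Operator

lemma exp_mul_eq_of_mul_eq {X Y P : Matrix (Fin n) (Fin n) ℂ} (h : P * X = Y * P) :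
    P * NormedSpace.exp X = NormedSpace.exp Y * P :=
  SemiconjBy.exp_right (x := P) h

lemma exp_mulVec_of_eigenvector {C : Matrix (Fin n) (Fin n) ℂ} {μ : ℂ} {v : Fin n → ℂ}
    (h : C *ᵥ v = μ • v) : NormedSpace.exp C *ᵥ v = Complex.exp μ • v := by
  -- The eigenvector equation is written as an intertwining relation by a square matrix all of whose
  -- columns are `v`; intertwining passes to exponentials.
  have h1 : Matrix.of (fun i _ => v i) * Matrix.diagonal (fun _ : Fin n => μ) =
      C * Matrix.of (fun i (_ : Fin n) => v i) := by
    ext i j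
    have := congrFun h i
    simp only [Matrix.mulVec, dotProduct, Pi.smul_apply, smul_eq_mul] at this
    rw [Matrix.mul_diagonal, Matrix.mul_apply]
    simp [this, mul_comm]
  have h2 := exp_mul_eq_of_mul_eq h1
  rw [Matrix.exp_diagonal] at h2
  ext i
  have h3 := congrFun (congrFun h2 i) i
  rw [Matrix.mul_diagonal, Matrix.mul_apply, Pi.coe_exp, ← Complex.exp_eq_exp_ℂ] at h3
  simp only [Matrix.of_apply] at h3
  simp only [Matrix.mulVec, dotProduct, Pi.smul_apply, smul_eq_mul]
  rw [← h3, mul_comm]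

/-- The nontrivial half of spectral mapping: an eigenspace of `exp C` is invariant under `C`, which
commutes with it, so it contains an eigenvector of `C`. -/
lemma exists_eigenvector_of_mem_spectrum_exp {C : Matrix (Fin n) (Fin n) ℂ} {z : ℂ}
    (hz : z ∈ spectrum ℂ (NormedSpace.exp C)) :
    ∃ (μ : ℂ) (v : Fin n → ℂ), v ≠ 0 ∧ C *ᵥ v = μ • v ∧ z = Complex.exp μ := by
  rw [← Matrix.spectrum_toLin', ← Module.End.hasEigenvalue_iff_mem_spectrum] at hz
  set W := Module.End.eigenspace (Matrix.toLin' (NormedSpace.exp C)) z with hW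
  have hinv : ∀ v ∈ W, Matrix.toLin' C v ∈ W := by
    intro v hv
    rw [hW, Module.End.mem_eigenspace_iff] at hv ⊢
    simp only [Matrix.toLin'_apply] at hv ⊢
    rw [Matrix.mulVec_mulVec, ← exp_mul_eq_of_mul_eq (X := C) (Y := C) rfl,
      ← Matrix.mulVec_mulVec, hv, Matrix.mulVec_smul]
  have : Nontrivial W := (Submodule.nontrivial_iff_ne_bot).2 hz
  obtain ⟨μ, hμ⟩ := Module.End.exists_eigenvalue ((Matrix.toLin' C).restrict hinv)
  obtain ⟨v, hv⟩ := hμ.exists_hasEigenvector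
  have hv1 : Matrix.toLin' C v = μ • (v : Fin n → ℂ) := congrArg Subtype.val hv.apply_eq_smul
  have hv0 : (v : Fin n → ℂ) ≠ 0 := fun h => hv.2 (Subtype.ext h)
  rw [Matrix.toLin'_apply] at hv1
  refine ⟨μ, v, hv0, hv1, ?_⟩
  have h1 := exp_mulVec_of_eigenvector hv1
  have h2 := (Module.End.mem_eigenspace_iff.1 v.2)
  rw [Matrix.toLin'_apply, h1] at h2
  exact (smul_left_injective ℂ hv0 h2).symm

lemma continuous_exp_smul (C : Matrix (Fin n) (Fin n) ℂ) :
    Continuous fun s : ℝ => NormedSpace.exp ((s : ℂ) • C) := by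
  have : Continuous fun u : ℂ => NormedSpace.exp (u • C) :=
    continuous_iff_continuousAt.2 fun u => (hasDerivAt_exp_smul_const C u).continuousAt
  exact this.comp Complex.continuous_ofReal

/-- Stability puts the spectrum of `exp C` inside the open unit disc, and Gelfand's formula gives a
power of norm less than 1. -/
lemma exists_pow_norm_exp_lt [Nonempty (Fin n)] {C : Matrix (Fin n) (Fin n) ℂ} (hC : IsStable C) :
    ∃ (r : ℝ) (K : ℕ), 0 < r ∧ r < 1 ∧ 0 < K ∧ ‖NormedSpace.exp C ^ K‖ ≤ r := by
  have h1 : spectralRadius ℂ (NormedSpace.exp C) < (1 : NNReal) := by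
    refine spectrum.spectralRadius_lt_of_forall_lt _ fun z hz => ?_
    obtain ⟨μ, v, hv, hCv, rfl⟩ := exists_eigenvector_of_mem_spectrum_exp hz
    have := hC μ v hv hCv
    rw [← NNReal.coe_lt_coe, coe_nnnorm, Complex.norm_exp]
    simpa using this
  have h2 := spectrum.pow_norm_pow_one_div_tendsto_nhds_spectralRadius (NormedSpace.exp C)
  have h3 := (h2.eventually_lt_const h1).and (eventually_gt_atTop 0)
  obtain ⟨K, hK, hK0⟩ := h3.exists
  have h4 : ‖NormedSpace.exp C ^ K‖ ^ (1 / (K : ℝ)) < 1 := by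
    have := (ENNReal.ofReal_lt_iff_lt_toReal (by positivity) (by simp)).1 hK
    simpa using this
  have h5 : ‖NormedSpace.exp C ^ K‖ < 1 := by
    by_contra! h
    exact absurd h4 (not_lt.2 (Real.one_le_rpow h (by positivity)))
  -- A number strictly above the norm is taken so that `r > 0` and `log r` is meaningful even if the
  -- norm vanishes.
  obtain ⟨r, hr1, hr2⟩ := exists_between h5
  exact ⟨r, K, (norm_nonneg _).trans_lt hr1, hr2, hK0, hr1.le⟩

/-- Write s = mK + s' with 0 ≤ s' < K: the m blocks of length K contract by `r` each, and the
remainder is bounded by compactness. -/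
lemma exists_exp_decay {C : Matrix (Fin n) (Fin n) ℂ} (hC : IsStable C) :
    ∃ M a : ℝ, 0 < a ∧ ∀ s : ℝ, 0 ≤ s → ∀ i j,
      ‖NormedSpace.exp ((s : ℂ) • C) i j‖ ≤ M * Real.exp (-a * s) := by
  rcases isEmpty_or_nonempty (Fin n) with h | h
  · exact ⟨0, 1, one_pos, fun s _ i => (h.false i).elim⟩
  obtain ⟨r, K, hr0, hr1, hK, hrK⟩ := exists_pow_norm_exp_lt hC
  obtain ⟨M, hM⟩ := (isCompact_Icc (a := (0 : ℝ)) (b := K)).exists_bound_of_continuousOn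
    (continuous_exp_smul C).continuousOn
  have hK' : (0 : ℝ) < K := by exact_mod_cast hK
  have hM0 : 0 ≤ M := (norm_nonneg _).trans (hM 0 ⟨le_rfl, hK'.le⟩)
  have hlog : Real.log r < 0 := Real.log_neg hr0 hr1
  -- The rate makes e^{-as} = r^{s/K}; the factor `r⁻¹` pays for replacing s/K by its integer part.
  refine ⟨M * r⁻¹, -Real.log r / K, div_pos (neg_pos.2 hlog) hK', fun s hs i j => ?_⟩
  set m := ⌊s / K⌋₊ with hm
  have hm1 : (m : ℝ) ≤ s / K := Nat.floor_le (by positivity)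
  have hm2 : s / K < m + 1 := Nat.lt_floor_add_one _
  rw [le_div_iff₀ hK'] at hm1
  rw [div_lt_iff₀ hK'] at hm2
  have hdec : NormedSpace.exp ((s : ℂ) • C) =
      (NormedSpace.exp C ^ K) ^ m * NormedSpace.exp (((s - m * K : ℝ) : ℂ) • C) := by
    rw [← pow_mul, ← Matrix.exp_nsmul, ← Matrix.exp_add_of_commute]
    · congr 1
      rw [← Nat.cast_smul_eq_nsmul ℂ, ← add_smul]
      congr 1
      push_cast
      ring
    · exact ((Commute.refl C).smul_left _).smul_right _
  have hentry : ‖NormedSpace.exp ((s : ℂ) • C) i j‖ ≤ ‖NormedSpace.exp ((s : ℂ) • C)‖ := by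
    have := Matrix.linfty_opNorm_def (NormedSpace.exp ((s : ℂ) • C))
    rw [this, ← coe_nnnorm, NNReal.coe_le_coe]
    refine le_trans ?_ (Finset.le_sup (Finset.mem_univ i))
    exact Finset.single_le_sum (f := fun j => ‖NormedSpace.exp ((s : ℂ) • C) i j‖₊)
      (fun _ _ => zero_le) (Finset.mem_univ j)
  refine hentry.trans ?_
  rw [hdec]
  refine (norm_mul_le _ _).trans ?_
  have h1 : ‖(NormedSpace.exp C ^ K) ^ m‖ ≤ r ^ m := by
    rcases Nat.eq_zero_or_pos m with h0 | h0
    · rw [h0]; simp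
    · exact (norm_pow_le' _ h0).trans (pow_le_pow_left₀ (norm_nonneg _) hrK m)
  have h2 : ‖NormedSpace.exp (((s - m * K : ℝ) : ℂ) • C)‖ ≤ M :=
    hM _ ⟨by linarith, by linarith⟩
  have h3 : r ^ m ≤ r⁻¹ * Real.exp (-(-Real.log r / K) * s) := by
    have e1 : r ^ m = Real.exp (m * Real.log r) := by
      rw [Real.exp_nat_mul, Real.exp_log hr0]
    have e2 : r⁻¹ = Real.exp (-Real.log r) := by rw [Real.exp_neg, Real.exp_log hr0]
    rw [e1, e2, ← Real.exp_add, Real.exp_le_exp]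
    have : s / K < m + 1 := by rwa [div_lt_iff₀ hK']
    have e3 : -(-Real.log r / K) * s = Real.log r * (s / K) := by field_simp
    rw [e3]
    nlinarith
  calc _ ≤ (r⁻¹ * Real.exp (-(-Real.log r / K) * s)) * M :=
        mul_le_mul (h1.trans h3) h2 (norm_nonneg _) (by positivity)
    _ = _ := by ring

lemma hasDerivAt_exp_smul_entry (C : Matrix (Fin n) (Fin n) ℂ) (s : ℝ) (i j : Fin n) :
    HasDerivAt (fun s : ℝ => NormedSpace.exp ((s : ℂ) • C) i j)
      ((NormedSpace.exp ((s : ℂ) • C) * C) i j) s := by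
  have h : HasDerivAt (fun u : ℂ => NormedSpace.exp (u • C) i j)
      ((NormedSpace.exp ((s : ℂ) • C) * C) i j) s :=
    hasDerivAt_pi.1 (hasDerivAt_pi.1 (hasDerivAt_exp_smul_const C (s : ℂ)) i) j
  exact h.comp_ofReal

end MatrixExponential

/-! ### Causal exponentials and their Laplace transforms -/

/-- The entries of `exp (sC)`, cut off to `s > 0`. -/
def causalExp {n : ℕ} (C : Matrix (Fin n) (Fin n) ℂ) (i j : Fin n) (s : ℝ) : ℂ :=
  if 0 < s then NormedSpace.exp ((s : ℂ) • C) i j else 0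

section Causal

variable {n : ℕ} {C : Matrix (Fin n) (Fin n) ℂ}

lemma causalExp_eq_indicator (i j : Fin n) : causalExp C i j =
    (Set.Ioi 0).indicator fun s : ℝ => NormedSpace.exp ((s : ℂ) • C) i j := by
  ext s; simp [causalExp, Set.indicator_apply]

lemma continuous_exp_smul_entry (C : Matrix (Fin n) (Fin n) ℂ) (i j : Fin n) :
    Continuous fun s : ℝ => NormedSpace.exp ((s : ℂ) • C) i j :=
  continuous_iff_continuousAt.2 fun s => (hasDerivAt_exp_smul_entry C s i j).continuousAt

lemma measurable_causalExp (i j : Fin n) : Measurable (causalExp C i j) := by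
  rw [causalExp_eq_indicator]
  exact (continuous_exp_smul_entry C i j).measurable.indicator measurableSet_Ioi

lemma integrableOn_exp_entry (hC : IsStable C) (i j : Fin n) :
    IntegrableOn (fun s : ℝ => NormedSpace.exp ((s : ℂ) • C) i j) (Set.Ioi 0) := by
  obtain ⟨M, a, ha, h⟩ := exists_exp_decay hC
  refine Integrable.mono' ((integrableOn_exp_mul_Ioi (neg_lt_zero.2 ha) 0).const_mul M)
    (continuous_exp_smul_entry C i j).aestronglyMeasurable ?_
  filter_upwards [ae_restrict_mem measurableSet_Ioi] with s hs
  exact h s (le_of_lt hs) i j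

lemma integrable_causalExp (hC : IsStable C) (i j : Fin n) : Integrable (causalExp C i j) := by
  rw [causalExp_eq_indicator, integrable_indicator_iff measurableSet_Ioi]
  exact integrableOn_exp_entry hC i j

lemma exists_bound_causalExp (hC : IsStable C) :
    ∃ M : ℝ, ∀ i j s, ‖causalExp C i j s‖ ≤ M := by
  obtain ⟨M, a, ha, h⟩ := exists_exp_decay hC
  refine ⟨max M 0, fun i j s => ?_⟩
  unfold causalExp
  split_ifs with hs
  · refine (h s hs.le i j).trans ?_
    have h1 : Real.exp (-a * s) ≤ 1 := Real.exp_le_one_iff.2 (by nlinarith)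
    calc M * Real.exp (-a * s) ≤ max M 0 * Real.exp (-a * s) :=
          mul_le_mul_of_nonneg_right (le_max_left _ _) (Real.exp_pos _).le
      _ ≤ max M 0 * 1 := mul_le_mul_of_nonneg_left h1 (le_max_right _ _)
      _ = _ := mul_one _
  · simp

/-- The Laplace transform of a decaying matrix exponential is the resolvent. -/
lemma laplace_causalExp (hC : IsStable C) {ζ : ℂ} (hζ : ζ.re ≤ 0) (i j : Fin n) :
    Integrable (fun s : ℝ => Complex.exp (ζ * s) * causalExp C i j s) ∧
    ∫ s : ℝ, Complex.exp (ζ * s) * causalExp C i j s = ((-ζ) • 1 - C)⁻¹ i j := by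
  have hint : ∀ i j, IntegrableOn
      (fun s : ℝ => Complex.exp (ζ * s) * NormedSpace.exp ((s : ℂ) • C) i j) (Set.Ioi 0) := by
    intro i j
    refine (integrableOn_exp_entry hC i j).norm.mono'
      (((by fun_prop : Continuous fun s : ℝ => Complex.exp (ζ * s)).mul
        (continuous_exp_smul_entry C i j)).aestronglyMeasurable) ?_
    filter_upwards [ae_restrict_mem measurableSet_Ioi] with s hs
    rw [norm_mul, Complex.norm_exp]
    refine mul_le_of_le_one_left (norm_nonneg _) (Real.exp_le_one_iff.2 ?_)
    have : 0 < s := hs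
    simp only [Complex.mul_re, Complex.ofReal_re, Complex.ofReal_im, mul_zero, sub_zero]
    nlinarith
  have hind : ∀ i j, (fun s : ℝ => Complex.exp (ζ * s) * causalExp C i j s) =
      (Set.Ioi 0).indicator
        fun s : ℝ => Complex.exp (ζ * s) * NormedSpace.exp ((s : ℂ) • C) i j := by
    intro i j
    ext s
    simp [causalExp, Set.indicator_apply]
  rw [hind, integrable_indicator_iff measurableSet_Ioi, integral_indicator measurableSet_Ioi]
  refine ⟨hint i j, ?_⟩
  set J : Matrix (Fin n) (Fin n) ℂ := Matrix.of fun i j =>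
    ∫ s in Set.Ioi (0 : ℝ), Complex.exp (ζ * s) * NormedSpace.exp ((s : ℂ) • C) i j with hJ
  -- The derivative of e^{ζs} exp(sC) is -e^{ζs} exp(sC)(-ζ - C). Integrating it from s = 0, where
  -- the function is the identity, to infinity, where it vanishes, gives J(-ζ - C) = 1.
  have hmul : J * ((-ζ) • 1 - C) = 1 := by
    ext i j
    have hderiv : ∀ s : ℝ, HasDerivAt
        (fun s : ℝ => Complex.exp (ζ * s) * NormedSpace.exp ((s : ℂ) • C) i j)
        (-∑ k, (Complex.exp (ζ * s) * NormedSpace.exp ((s : ℂ) • C) i k) *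
          ((-ζ) • (1 : Matrix (Fin n) (Fin n) ℂ) - C) k j) s := by
      intro s
      have h1 : HasDerivAt (fun s : ℝ => Complex.exp (ζ * s)) (Complex.exp (ζ * s) * ζ) s := by
        have := ((hasDerivAt_id (s : ℂ)).const_mul ζ).cexp.comp_ofReal
        simpa using this
      refine (h1.mul (hasDerivAt_exp_smul_entry C s i j)).congr_deriv ?_
      have e1 : ∑ k, (Complex.exp (ζ * s) * NormedSpace.exp ((s : ℂ) • C) i k) *
          ((-ζ) • (1 : Matrix (Fin n) (Fin n) ℂ) - C) k j = Complex.exp (ζ * s) *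
          (NormedSpace.exp ((s : ℂ) • C) * ((-ζ) • (1 : Matrix (Fin n) (Fin n) ℂ) - C)) i j := by
        rw [Matrix.mul_apply, Finset.mul_sum]
        exact Finset.sum_congr rfl fun k _ => mul_assoc _ _ _
      rw [e1, mul_sub, Matrix.mul_smul, mul_one, Matrix.sub_apply, Matrix.smul_apply, smul_eq_mul]
      ring
    have hlim : Tendsto (fun s : ℝ => Complex.exp (ζ * s) * NormedSpace.exp ((s : ℂ) • C) i j)
        atTop (𝓝 0) := by
      obtain ⟨M, a, ha, h⟩ := exists_exp_decay hC
      have h0 : Tendsto (fun s : ℝ => M * Real.exp (-a * s)) atTop (𝓝 0) := by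
        have : Tendsto (fun s : ℝ => Real.exp (-a * s)) atTop (𝓝 0) :=
          Real.tendsto_exp_atBot.comp
            (tendsto_id.const_mul_atTop_of_neg (neg_lt_zero.2 ha))
        simpa using this.const_mul M
      refine squeeze_zero_norm' ?_ h0
      filter_upwards [eventually_ge_atTop 0] with s hs
      refine le_trans ?_ (h s hs i j)
      rw [norm_mul, Complex.norm_exp]
      refine mul_le_of_le_one_left (norm_nonneg _) (Real.exp_le_one_iff.2 ?_)
      simp only [Complex.mul_re, Complex.ofReal_re, Complex.ofReal_im, mul_zero, sub_zero]
      nlinarith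
    have hint' : IntegrableOn (fun s : ℝ =>
        -∑ k, (Complex.exp (ζ * s) * NormedSpace.exp ((s : ℂ) • C) i k) *
          ((-ζ) • (1 : Matrix (Fin n) (Fin n) ℂ) - C) k j) (Set.Ioi 0) :=
      (integrable_finsetSum _ fun k _ => (hint i k).mul_const _).neg
    have key := integral_Ioi_of_hasDerivAt_of_tendsto (hderiv 0).continuousAt.continuousWithinAt
      (fun s _ => hderiv s) hint' hlim
    rw [integral_neg, integral_finsetSum _ (fun k _ => (hint i k).mul_const _)] at key
    simp_rw [integral_mul_const] at key
    rw [Matrix.mul_apply]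
    simp only [hJ, Matrix.of_apply]
    have := neg_inj.1 (key.trans (zero_sub _))
    rw [this]
    simp
  rw [Matrix.inv_eq_left_inv hmul]
  rfl

end Causal

/-! ### Splitting off real eigenvalues and factoring the spectral density -/

section Realization

variable {n p : ℕ}

/-- The orthogonal projection onto the span of an orthonormal family. -/
def proj {m : ℕ} (u : Fin m → Fin n → ℂ) : Matrix (Fin n) (Fin n) ℂ :=
  ∑ k, Matrix.vecMulVec (u k) (star (u k))

/-- An orthonormal family of eigenvectors with real eigenvalues. -/
def IsRealEigenfamily {m : ℕ} (β : Matrix (Fin n) (Fin n) ℂ) (ev : Fin m → ℝ)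
    (u : Fin m → Fin n → ℂ) : Prop :=
  (∀ k j, star (u k) ⬝ᵥ u j = if k = j then 1 else 0) ∧
  ∀ k, β *ᵥ u k = (ev k : ℂ) • u k

lemma IsRealEigenfamily.le {m : ℕ} {β : Matrix (Fin n) (Fin n) ℂ} {ev : Fin m → ℝ}
    {u : Fin m → Fin n → ℂ} (h : IsRealEigenfamily β ev u) : m ≤ n := by
  set U : Matrix (Fin n) (Fin m) ℂ := Matrix.of fun i k => u k i
  have hU : Uᴴ * U = 1 := by
    ext k j
    rw [Matrix.one_apply, ← h.1 k j]
    rfl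
  have h1 := Matrix.rank_mul_le_right Uᴴ U
  rw [hU, Matrix.rank_one, Fintype.card_fin] at h1
  have h2 := Matrix.rank_le_height U
  omega

lemma dotProduct_star_self_pos {v : Fin n → ℂ} (hv : v ≠ 0) :
    ∃ r : ℝ, 0 < r ∧ star v ⬝ᵥ v = r := by
  have h := Matrix.dotProduct_star_self_pos_iff.2 hv
  rw [Complex.lt_def] at h
  exact ⟨_, h.1, Complex.ext rfl h.2.symm⟩

/-- Otherwise every family could be extended by a normalized vector orthogonal to it, producing n +
1 orthonormal vectors in dimension n. -/
lemma exists_maximal_realEigenfamily (β : Matrix (Fin n) (Fin n) ℂ) :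
    ∃ (m : ℕ) (ev : Fin m → ℝ) (u : Fin m → Fin n → ℂ), IsRealEigenfamily β ev u ∧
      ∀ (μ : ℝ) (v : Fin n → ℂ), β *ᵥ v = (μ : ℂ) • v → (∀ k, star (u k) ⬝ᵥ v = 0) → v = 0 := by
  by_contra! H
  have : ∀ m : ℕ, ∃ (ev : Fin m → ℝ) (u : Fin m → Fin n → ℂ), IsRealEigenfamily β ev u := by
    intro m
    induction m with
    | zero => exact ⟨fun k => k.elim0, fun k => k.elim0, fun k => k.elim0, fun k => k.elim0⟩
    | succ m ih =>
      obtain ⟨ev, u, h⟩ := ih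
      obtain ⟨μ, v, hv, hu, hv0⟩ := H m ev u h
      obtain ⟨r, hr, hvr⟩ := dotProduct_star_self_pos hv0
      set c : ℂ := (((Real.sqrt r)⁻¹ : ℝ) : ℂ)
      have hc : c * (star c * (r : ℂ)) = 1 := by
        rw [Complex.star_def, Complex.conj_ofReal, ← Complex.ofReal_mul, ← Complex.ofReal_mul]
        norm_cast
        have := Real.mul_self_sqrt hr.le
        have hs : Real.sqrt r ≠ 0 := (Real.sqrt_pos.2 hr).ne'
        field_simp
        linarith
      have hu' : ∀ k, star v ⬝ᵥ u k = 0 := fun k => by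
        have := congrArg star (hu k)
        rwa [← Matrix.star_dotProduct, star_zero] at this
      refine ⟨Fin.cons μ ev, Fin.cons (c • v) u, ?_, ?_⟩
      · intro k j
        refine Fin.cases ?_ (fun k => ?_) k <;> refine Fin.cases ?_ (fun j => ?_) j
        · simp only [Fin.cons_zero, star_smul, smul_dotProduct, dotProduct_smul, hvr, smul_eq_mul,
            hc, if_true]
        · simp [hu', (Fin.succ_ne_zero _).symm]
        · simp [hu]
        · simp [h.1]
      · intro k
        refine Fin.cases ?_ (fun k => ?_) k
        · simp [Matrix.mulVec_smul, hv, smul_comm c]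
        · simpa using h.2 k
  obtain ⟨ev, u, h⟩ := this (n + 1)
  have := h.le
  omega

lemma diagD_inv {d : Fin p → ℝ} (hd : ∀ i, 0 < d i) :
    (diagD d)⁻¹ = Matrix.diagonal fun i => ((d i)⁻¹ : ℂ) := by
  refine Matrix.inv_eq_left_inv ?_
  rw [diagD, Matrix.diagonal_mul_diagonal, ← Matrix.diagonal_one]
  congr 1
  ext i
  exact inv_mul_cancel₀ (Complex.ofReal_ne_zero.2 (hd i).ne')

lemma star_dotProduct_diagD_inv {d : Fin p → ℝ} (hd : ∀ i, 0 < d i) (y : Fin p → ℂ) :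
    star y ⬝ᵥ ((diagD d)⁻¹ *ᵥ y) = ((∑ i, ‖y i‖ ^ 2 / d i : ℝ) : ℂ) := by
  rw [diagD_inv hd, dotProduct]
  push_cast
  refine Finset.sum_congr rfl fun i _ => ?_
  rw [Matrix.mulVec_diagonal, Pi.star_apply, Complex.star_def, ← Complex.conj_mul']
  ring

lemma star_dotProduct_dissipation {d : Fin p → ℝ} (hd : ∀ i, 0 < d i)
    (Δ : Matrix (Fin n) (Fin p) ℂ) (v : Fin n → ℂ) :
    star v ⬝ᵥ ((Δ * (diagD d)⁻¹ * Δᴴ) *ᵥ v) = ((∑ i, ‖(Δᴴ *ᵥ v) i‖ ^ 2 / d i : ℝ) : ℂ) := by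
  rw [← star_dotProduct_diagD_inv hd, Matrix.mul_assoc, ← Matrix.mulVec_mulVec,
    ← Matrix.mulVec_mulVec, Matrix.dotProduct_mulVec, Matrix.star_mulVec, Matrix.conjTranspose_conjTranspose]

lemma star_dotProduct_conjTranspose_mulVec (A : Matrix (Fin n) (Fin n) ℂ) (v : Fin n → ℂ) :
    star v ⬝ᵥ (Aᴴ *ᵥ v) = star (star v ⬝ᵥ (A *ᵥ v)) := by
  rw [Matrix.dotProduct_mulVec, ← Matrix.star_mulVec, ← Matrix.star_dotProduct_star, star_star,
    dotProduct_comm]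

/-- Eigenvalues of a dissipative matrix, and eigenvectors to its real eigenvalues. -/
lemma eigenvector_dissipative {d : Fin p → ℝ} (hd : ∀ i, 0 < d i)
    {β : Matrix (Fin n) (Fin n) ℂ} {Δ : Matrix (Fin n) (Fin p) ℂ}
    (hβ : βᴴ - β = Complex.I • (Δ * (diagD d)⁻¹ * Δᴴ)) {μ : ℂ} {v : Fin n → ℂ}
    (hv0 : v ≠ 0) (hv : β *ᵥ v = μ • v) :
    μ.im ≤ 0 ∧ (μ.im = 0 → Δᴴ *ᵥ v = 0) := by
  obtain ⟨r, hr, hvr⟩ := dotProduct_star_self_pos hv0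
  -- The form of β* - β at `v` is evaluated twice: by the eigenvalue it is -2i Im μ ‖v‖², by the
  -- hypothesis it is i times the nonnegative sum `q`.
  have h1 : star v ⬝ᵥ ((βᴴ - β) *ᵥ v) = (conj μ - μ) * r := by
    rw [Matrix.sub_mulVec, dotProduct_sub, star_dotProduct_conjTranspose_mulVec, hv,
      dotProduct_smul, hvr, smul_eq_mul, star_mul', Complex.star_def, Complex.conj_ofReal]
    ring
  rw [hβ, Matrix.smul_mulVec, dotProduct_smul, star_dotProduct_dissipation hd, smul_eq_mul] at h1
  set q := ∑ i, ‖(Δᴴ *ᵥ v) i‖ ^ 2 / d i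
  have hq : 0 ≤ q := Finset.sum_nonneg fun i _ => div_nonneg (sq_nonneg _) (hd i).le
  have h2 := congrArg Complex.im h1
  simp at h2
  refine ⟨by nlinarith, fun h => ?_⟩
  rw [h] at h2
  have hq0 : q = 0 := by linarith
  ext i
  have := (Finset.sum_eq_zero_iff_of_nonneg
    (fun i _ => div_nonneg (sq_nonneg _) (hd i).le)).1 hq0 i (Finset.mem_univ i)
  simpa [(hd i).ne'] using this

section Family

variable {m : ℕ} {d : Fin p → ℝ} {β : Matrix (Fin n) (Fin n) ℂ} {Δ : Matrix (Fin n) (Fin p) ℂ}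
  {ev : Fin m → ℝ} {u : Fin m → Fin n → ℂ}

lemma IsRealEigenfamily.ne_zero (h : IsRealEigenfamily β ev u) (k : Fin m) : u k ≠ 0 := by
  intro h0
  have := h.1 k k
  simp [h0] at this

lemma IsRealEigenfamily.conjTranspose_mulVec_eq_zero (hd : ∀ i, 0 < d i)
    (hβ : βᴴ - β = Complex.I • (Δ * (diagD d)⁻¹ * Δᴴ)) (h : IsRealEigenfamily β ev u)
    (k : Fin m) : Δᴴ *ᵥ u k = 0 :=
  (eigenvector_dissipative hd hβ (h.ne_zero k) (h.2 k)).2 (Complex.ofReal_im _)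

/-- On the kernel of Δ* the imaginary part of β vanishes; this makes real eigenvectors reducing. -/
lemma conjTranspose_mulVec_eigenvector (hβ : βᴴ - β = Complex.I • (Δ * (diagD d)⁻¹ * Δᴴ))
    {v : Fin n → ℂ} (hv : Δᴴ *ᵥ v = 0) : βᴴ *ᵥ v = β *ᵥ v := by
  have : (βᴴ - β) *ᵥ v = 0 := by
    rw [hβ, Matrix.smul_mulVec, ← Matrix.mulVec_mulVec, hv, Matrix.mulVec_zero, smul_zero]
  rwa [Matrix.sub_mulVec, sub_eq_zero] at this

lemma conjTranspose_proj : (proj u)ᴴ = proj u := by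
  simp [proj, Matrix.conjTranspose_sum, Matrix.conjTranspose_vecMulVec]

lemma proj_mulVec (v : Fin n → ℂ) : proj u *ᵥ v = ∑ k, (star (u k) ⬝ᵥ v) • u k := by
  rw [proj, Matrix.sum_mulVec]
  refine Finset.sum_congr rfl fun k _ => ?_
  rw [Matrix.vecMulVec_mulVec]
  simp

lemma star_dotProduct_proj (v : Fin n → ℂ) :
    star v ⬝ᵥ (proj u *ᵥ v) = ((∑ k, ‖star (u k) ⬝ᵥ v‖ ^ 2 : ℝ) : ℂ) := by
  rw [proj_mulVec, dotProduct_sum]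
  push_cast
  refine Finset.sum_congr rfl fun k _ => ?_
  rw [dotProduct_smul, smul_eq_mul, ← Complex.mul_conj', ← Complex.star_def,
    ← Matrix.star_dotProduct_star, star_star, dotProduct_comm (star v)]

lemma mul_proj {q : ℕ} (A : Matrix (Fin q) (Fin n) ℂ) :
    A * proj u = ∑ k, Matrix.vecMulVec (A *ᵥ u k) (star (u k)) := by
  simp [proj, Matrix.mul_sum, Matrix.mul_vecMulVec]

lemma IsRealEigenfamily.proj_mulVec_self (h : IsRealEigenfamily β ev u) (k : Fin m) :
    proj u *ᵥ u k = u k := by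
  rw [proj_mulVec]
  simp [h.1]

lemma IsRealEigenfamily.proj_mul_proj (h : IsRealEigenfamily β ev u) :
    proj u * proj u = proj u := by
  rw [mul_proj]
  simp only [h.proj_mulVec_self]
  rfl

/-- The projected data (1 - P)Θ₁ and (1 - P)Θ₂ thus keep the difference Δ, and Θ₁*, Θ₂* agree on the
split-off vectors. -/
lemma IsRealEigenfamily.proj_mul_dissipation (hd : ∀ i, 0 < d i)
    (hβ : βᴴ - β = Complex.I • (Δ * (diagD d)⁻¹ * Δᴴ)) (h : IsRealEigenfamily β ev u) :
    proj u * Δ = 0 := by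
  have : Δᴴ * proj u = 0 := by
    rw [mul_proj]
    simp [h.conjTranspose_mulVec_eq_zero hd hβ]
  have := congrArg Matrix.conjTranspose this
  rwa [Matrix.conjTranspose_mul, Matrix.conjTranspose_conjTranspose, conjTranspose_proj,
    Matrix.conjTranspose_zero] at this

lemma IsRealEigenfamily.conjTranspose_mul_proj (hd : ∀ i, 0 < d i)
    (hβ : βᴴ - β = Complex.I • (Δ * (diagD d)⁻¹ * Δᴴ)) (h : IsRealEigenfamily β ev u) :
    βᴴ * proj u = β * proj u := by
  rw [mul_proj, mul_proj]
  simp only [conjTranspose_mulVec_eigenvector hβ (h.conjTranspose_mulVec_eq_zero hd hβ _)]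

/-- Real eigenvalues make βP self-adjoint, and β*P = βP has adjoint Pβ = Pβ*. So βP = (βP)* = Pβ* =
Pβ. -/
lemma IsRealEigenfamily.proj_comm (hd : ∀ i, 0 < d i)
    (hβ : βᴴ - β = Complex.I • (Δ * (diagD d)⁻¹ * Δᴴ)) (h : IsRealEigenfamily β ev u) :
    β * proj u = proj u * β := by
  have h1 : β * proj u = ∑ k, Matrix.vecMulVec ((ev k : ℂ) • u k) (star (u k)) := by
    rw [mul_proj]
    simp only [h.2]
  have h2 : (β * proj u)ᴴ = β * proj u := by
    rw [h1]
    simp [Matrix.conjTranspose_sum, Matrix.conjTranspose_vecMulVec, Matrix.smul_vecMulVec,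
      Matrix.conjTranspose_smul]
  rw [← h2, Matrix.conjTranspose_mul, conjTranspose_proj]
  have h3 := congrArg Matrix.conjTranspose (h.conjTranspose_mul_proj hd hβ)
  rw [Matrix.conjTranspose_mul, Matrix.conjTranspose_mul, conjTranspose_proj,
    Matrix.conjTranspose_conjTranspose] at h3
  exact h3.symm

lemma IsRealEigenfamily.proj_comm' (hd : ∀ i, 0 < d i)
    (hβ : βᴴ - β = Complex.I • (Δ * (diagD d)⁻¹ * Δᴴ)) (h : IsRealEigenfamily β ev u) :
    βᴴ * proj u = proj u * βᴴ := by
  have h3 := congrArg Matrix.conjTranspose (h.proj_comm hd hβ)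
  rw [Matrix.conjTranspose_mul, Matrix.conjTranspose_mul, conjTranspose_proj] at h3
  exact h3.symm

/-- The generator obtained from `iβ^*` by moving its purely imaginary eigenvalues to the left. -/
def stableGenerator (β : Matrix (Fin n) (Fin n) ℂ) (u : Fin m → Fin n → ℂ) :
    Matrix (Fin n) (Fin n) ℂ :=
  Complex.I • βᴴ - proj u

/-- Subtracting P adds a strictly dissipative term in exactly the directions where iβ* only rotates.
-/
lemma stableGenerator_add_conjTranspose
    (hβ : βᴴ - β = Complex.I • (Δ * (diagD d)⁻¹ * Δᴴ)) :
    stableGenerator β u + (stableGenerator β u)ᴴ =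
      -(Δ * (diagD d)⁻¹ * Δᴴ) - (2 : ℂ) • proj u := by
  have h1 : Δ * (diagD d)⁻¹ * Δᴴ = -(Complex.I • (βᴴ - β)) := by
    rw [hβ, smul_smul, Complex.I_mul_I]
    simp
  rw [h1, stableGenerator, Matrix.conjTranspose_sub, Matrix.conjTranspose_smul,
    conjTranspose_proj, Matrix.conjTranspose_conjTranspose, Complex.star_def, Complex.conj_I,
    smul_sub, two_smul, neg_smul]
  abel

/-- If Re μ ≥ 0, the dissipation identity forces Δ*v = 0, v ⊥ u_k and Re μ = 0. Then Cv = iβ*v =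
iβv, so `v` is a real eigenvector of β orthogonal to the family, contradicting maximality. -/
lemma isStable_stableGenerator (hd : ∀ i, 0 < d i)
    (hβ : βᴴ - β = Complex.I • (Δ * (diagD d)⁻¹ * Δᴴ))
    (hmax : ∀ (μ : ℝ) (v : Fin n → ℂ), β *ᵥ v = (μ : ℂ) • v →
      (∀ k, star (u k) ⬝ᵥ v = 0) → v = 0) : IsStable (stableGenerator β u) := by
  intro μ v hv0 hv
  by_contra! hμ
  obtain ⟨r, hr, hvr⟩ := dotProduct_star_self_pos hv0
  have h1 : star v ⬝ᵥ ((stableGenerator β u + (stableGenerator β u)ᴴ) *ᵥ v) =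
      (μ + conj μ) * r := by
    rw [Matrix.add_mulVec, dotProduct_add, star_dotProduct_conjTranspose_mulVec, hv,
      dotProduct_smul, hvr, smul_eq_mul, star_mul', Complex.star_def, Complex.conj_ofReal]
    ring
  rw [stableGenerator_add_conjTranspose hβ, Matrix.sub_mulVec, Matrix.neg_mulVec,
    Matrix.smul_mulVec, dotProduct_sub, dotProduct_neg, dotProduct_smul,
    star_dotProduct_dissipation hd, star_dotProduct_proj, Complex.add_conj, smul_eq_mul] at h1
  set q := ∑ i, ‖(Δᴴ *ᵥ v) i‖ ^ 2 / d i
  set t := ∑ k, ‖star (u k) ⬝ᵥ v‖ ^ 2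
  have hq : 0 ≤ q := Finset.sum_nonneg fun i _ => div_nonneg (sq_nonneg _) (hd i).le
  have ht : 0 ≤ t := Finset.sum_nonneg fun i _ => sq_nonneg _
  have h2 : -q - 2 * t = 2 * μ.re * r := by exact_mod_cast h1
  have h3 : 0 ≤ μ.re * r := mul_nonneg hμ hr.le
  have hq0 : q = 0 := by nlinarith
  have ht0 : t = 0 := by nlinarith
  have hμ0 : μ.re = 0 := by
    have : μ.re * r = 0 := by nlinarith
    exact (mul_eq_zero.1 this).resolve_right hr.ne'
  have hΔ : Δᴴ *ᵥ v = 0 := by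
    ext i
    have := (Finset.sum_eq_zero_iff_of_nonneg
      (fun i _ => div_nonneg (sq_nonneg _) (hd i).le)).1 hq0 i (Finset.mem_univ i)
    simpa [(hd i).ne'] using this
  have hu : ∀ k, star (u k) ⬝ᵥ v = 0 := fun k => by
    have := (Finset.sum_eq_zero_iff_of_nonneg (fun i _ => sq_nonneg _)).1 ht0 k (Finset.mem_univ k)
    simpa using this
  refine hv0 (hmax μ.im v ?_ hu)
  have h4 : proj u *ᵥ v = 0 := by
    rw [proj_mulVec]
    simp [hu]
  rw [stableGenerator, Matrix.sub_mulVec, h4, sub_zero, Matrix.smul_mulVec,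
    conjTranspose_mulVec_eigenvector hβ hΔ] at hv
  have h5 := congrArg (fun w => (-Complex.I) • w) hv
  simp only [smul_smul] at h5
  rw [neg_mul, Complex.I_mul_I, neg_neg, one_smul] at h5
  rw [h5]
  congr 1
  apply Complex.ext <;> simp [hμ0]

end Family

lemma IsStable.isUnit_det {C : Matrix (Fin n) (Fin n) ℂ} (hC : IsStable C) {ζ : ℂ}
    (hζ : 0 ≤ ζ.re) : IsUnit (ζ • 1 - C).det := by
  rw [isUnit_iff_ne_zero]
  intro h
  obtain ⟨v, hv0, hv⟩ := Matrix.exists_mulVec_eq_zero_iff.2 h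
  rw [Matrix.sub_mulVec, Matrix.smul_mulVec, Matrix.one_mulVec, sub_eq_zero] at hv
  exact absurd (hC ζ v hv0 hv.symm) (not_lt.2 hζ)

lemma isUnit_det_dissipative {d : Fin p → ℝ} (hd : ∀ i, 0 < d i)
    {β : Matrix (Fin n) (Fin n) ℂ} {Δ : Matrix (Fin n) (Fin p) ℂ}
    (hβ : βᴴ - β = Complex.I • (Δ * (diagD d)⁻¹ * Δᴴ)) {w : ℂ} (hw : 0 < w.im) :
    IsUnit (β - w • 1).det := by
  rw [isUnit_iff_ne_zero]
  intro h
  obtain ⟨v, hv0, hv⟩ := Matrix.exists_mulVec_eq_zero_iff.2 h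
  rw [Matrix.sub_mulVec, Matrix.smul_mulVec, Matrix.one_mulVec, sub_eq_zero] at hv
  exact absurd (eigenvector_dissipative hd hβ hv0 hv).1 (not_le.2 hw)

/-- Positivity of the spectral density: `D + H + H^* = G^* D⁻¹ G`. -/
lemma density_factorization {D Dinv : Matrix (Fin p) (Fin p) ℂ} (hD : D * Dinv = 1)
    (hDh : Dᴴ = D) {X₁ X₂ : Matrix (Fin n) (Fin p) ℂ} {E F P : Matrix (Fin n) (Fin n) ℂ}
    (hEF : E * F = 1) (hF : F + Fᴴ = (X₂ - X₁) * Dinv * (X₂ - X₁)ᴴ + (2 : ℂ) • P)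
    (hP : X₂ᴴ * E * P = 0) :
    D + X₂ᴴ * E * X₁ + (X₂ᴴ * E * X₁)ᴴ =
      (D - (X₂ᴴ * E * (X₂ - X₁))ᴴ)ᴴ * Dinv * (D - (X₂ᴴ * E * (X₂ - X₁))ᴴ) := by
  have hD' : Dinv * D = 1 := mul_eq_one_comm.1 hD
  set Δ := X₂ - X₁ with hΔ
  have hFE : Fᴴ * Eᴴ = 1 := by rw [← Matrix.conjTranspose_mul, hEF, Matrix.conjTranspose_one]
  have h1 : (D - (X₂ᴴ * E * Δ)ᴴ)ᴴ * Dinv * (D - (X₂ᴴ * E * Δ)ᴴ) =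
      D - X₂ᴴ * E * Δ - (X₂ᴴ * E * Δ)ᴴ +
        X₂ᴴ * E * (Δ * Dinv * Δᴴ) * (Eᴴ * X₂) := by
    simp only [Matrix.conjTranspose_sub, Matrix.conjTranspose_mul, Matrix.conjTranspose_conjTranspose,
      hDh, Matrix.sub_mul, Matrix.mul_sub, hD, Matrix.one_mul]
    simp only [Matrix.mul_assoc, hD', Matrix.mul_one]
    abel
  -- Since E inverts F, E(F + F*)E* = E + E*; the projection term is annihilated by `hP`. So the
  -- quadratic term of the expanded product becomes linear in E.
  have h2 : X₂ᴴ * E * (Δ * Dinv * Δᴴ) * (Eᴴ * X₂) = X₂ᴴ * Eᴴ * X₂ + X₂ᴴ * E * X₂ := by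
    have : Δ * Dinv * Δᴴ = F + Fᴴ - (2 : ℂ) • P := by rw [hF]; abel
    rw [this, Matrix.mul_sub, Matrix.mul_smul, hP, smul_zero, sub_zero, Matrix.mul_add,
      Matrix.add_mul, Matrix.mul_assoc X₂ᴴ E F, hEF, Matrix.mul_one, ← Matrix.mul_assoc X₂ᴴ Eᴴ,
      Matrix.mul_assoc (X₂ᴴ * E) Fᴴ, ← Matrix.mul_assoc Fᴴ, hFE, Matrix.one_mul]
  rw [h1, h2, hΔ, Matrix.mul_sub, Matrix.conjTranspose_sub]
  simp only [Matrix.conjTranspose_mul, Matrix.conjTranspose_conjTranspose, Matrix.mul_assoc]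
  abel

/-- The identity det(1 + AB) = det(1 + BA) moves the determinant from size p to size n, where it
becomes, up to nonvanishing factors, the characteristic polynomial of the fixed matrix i(C* +
XD⁻¹Δ*) at z. -/
lemma finite_det_eq_zero {D Dinv : Matrix (Fin p) (Fin p) ℂ} (hD : D * Dinv = 1)
    (X Δ : Matrix (Fin n) (Fin p) ℂ) {C : Matrix (Fin n) (Fin n) ℂ} (hC : IsStable C) :
    {z : ℝ | (D - (Xᴴ * ((Complex.I * z) • 1 - C)⁻¹ * Δ)ᴴ).det = 0}.Finite := by
  set B := Complex.I • (Cᴴ + X * Dinv * Δᴴ) with hB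
  have hfin : {z : ℂ | B.charpoly.IsRoot z}.Finite :=
    Polynomial.finite_setOfPred_isRoot B.charpoly_monic.ne_zero
  refine (hfin.preimage (f := fun z : ℝ => (z : ℂ)) Complex.ofReal_injective.injOn).subset ?_
  intro z hz
  simp only [Set.mem_ofPred_eq] at hz
  simp only [Set.mem_preimage, Set.mem_ofPred_eq, Polynomial.IsRoot, Matrix.eval_charpoly]
  set F := (Complex.I * z) • (1 : Matrix (Fin n) (Fin n) ℂ) - C with hF
  have hFu : IsUnit F.det := hC.isUnit_det (by simp)
  have hFE : Fᴴ * F⁻¹ᴴ = 1 := by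
    rw [← Matrix.conjTranspose_mul, Matrix.nonsing_inv_mul _ hFu, Matrix.conjTranspose_one]
  have h1 : D - (Xᴴ * F⁻¹ * Δ)ᴴ = D * (1 + (Dinv * Δᴴ) * (-(F⁻¹ᴴ * X))) := by
    rw [mul_add, mul_one, ← Matrix.mul_assoc, ← Matrix.mul_assoc, hD, Matrix.one_mul]
    simp only [Matrix.conjTranspose_mul, Matrix.conjTranspose_conjTranspose, Matrix.mul_neg]
    abel
  have hD0 : D.det ≠ 0 := fun h => by
    have := congrArg Matrix.det hD
    rw [Matrix.det_mul, h] at this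
    simp at this
  rw [h1, Matrix.det_mul, Matrix.det_one_add_mul_comm] at hz
  have hz' := (mul_eq_zero.1 hz).resolve_left hD0
  have h2 : Matrix.scalar (Fin n) (z : ℂ) - B =
      Complex.I • (Fᴴ * (1 + -(F⁻¹ᴴ * X) * (Dinv * Δᴴ))) := by
    have e : Fᴴ * (1 + -(F⁻¹ᴴ * X) * (Dinv * Δᴴ)) = Fᴴ - X * Dinv * Δᴴ := by
      rw [mul_add, mul_one, Matrix.neg_mul, Matrix.mul_neg, Matrix.mul_assoc F⁻¹ᴴ,
        ← Matrix.mul_assoc Fᴴ, hFE, one_mul, Matrix.mul_assoc X]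
      abel
    rw [e, hF, hB, Matrix.conjTranspose_sub, Matrix.conjTranspose_smul, Matrix.conjTranspose_one]
    have e2 : Matrix.scalar (Fin n) (z : ℂ) = (z : ℂ) • (1 : Matrix (Fin n) (Fin n) ℂ) := by
      rw [Matrix.smul_one_eq_diagonal]; rfl
    have e3 : Complex.I * star (Complex.I * (z : ℂ)) = z := by
      simp [← mul_assoc]
    rw [e2, smul_sub, smul_sub, smul_smul, e3, smul_add]
    abel
  rw [h2, Matrix.det_smul, Matrix.det_mul, hz', mul_zero, mul_zero]

/-- Splitting off the real eigenvalues of `β` from the realization `(β, Θ₁, Θ₂)`. -/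
theorem exists_stable_realization {d : Fin p → ℝ} (hd : ∀ i, 0 < d i)
    (β : Matrix (Fin n) (Fin n) ℂ) (Θ₁ Θ₂ : Matrix (Fin n) (Fin p) ℂ)
    (hβ : βᴴ - β = Complex.I • ((Θ₂ - Θ₁) * (diagD d)⁻¹ * (Θ₂ - Θ₁)ᴴ)) :
    ∃ (m : ℕ) (ev : Fin m → ℝ) (a : Fin m → Fin p → ℂ) (C : Matrix (Fin n) (Fin n) ℂ)
      (X₁ X₂ : Matrix (Fin n) (Fin p) ℂ), IsStable C ∧
      (∀ s : ℝ, Θ₂ᴴ * NormedSpace.exp ((Complex.I * (s : ℂ)) • βᴴ) * Θ₁ =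
        X₂ᴴ * NormedSpace.exp ((s : ℂ) • C) * X₁ +
          ∑ k, Complex.exp (Complex.I * s * ev k) • Matrix.vecMulVec (a k) (star (a k))) ∧
      (∀ w : ℂ, 0 < w.im → Θ₁ᴴ * (β - w • (1 : Matrix (Fin n) (Fin n) ℂ))⁻¹ * Θ₂ =
        Complex.I • (X₂ᴴ * ((Complex.I * conj w) • 1 - C)⁻¹ * X₁)ᴴ +
          ∑ k, ((ev k : ℂ) - w)⁻¹ • Matrix.vecMulVec (a k) (star (a k))) ∧
      ∀ z : ℝ, diagD d + X₂ᴴ * ((Complex.I * z) • 1 - C)⁻¹ * X₁ +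
          (X₂ᴴ * ((Complex.I * z) • 1 - C)⁻¹ * X₁)ᴴ =
        (diagD d - (X₂ᴴ * ((Complex.I * z) • 1 - C)⁻¹ * (X₂ - X₁))ᴴ)ᴴ * (diagD d)⁻¹ *
          (diagD d - (X₂ᴴ * ((Complex.I * z) • 1 - C)⁻¹ * (X₂ - X₁))ᴴ) := by
  obtain ⟨m, ev, u, hu, hmax⟩ := exists_maximal_realEigenfamily β
  set Δ := Θ₂ - Θ₁ with hΔ
  set P := proj u with hP
  set Q := 1 - P with hQ
  set C := stableGenerator β u with hCdef
  have hC : IsStable C := isStable_stableGenerator hd hβ hmax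
  have hPP : P * P = P := hu.proj_mul_proj
  have hQP : Q * P = 0 := by rw [hQ, sub_mul, one_mul, hPP, sub_self]
  have hQQ : Q * Q = Q := by rw [hQ, mul_sub, mul_one, ← hQ, hQP, sub_zero]
  have hQh : Qᴴ = Q := by rw [hQ, Matrix.conjTranspose_sub, Matrix.conjTranspose_one, hP,
    conjTranspose_proj]
  have hPΔ : P * Δ = 0 := hu.proj_mul_dissipation hd hβ
  have hQβ : Q * β = β * Q := by
    rw [hQ, sub_mul, mul_sub, one_mul, mul_one, hu.proj_comm hd hβ]
  have hQβ' : Q * βᴴ = βᴴ * Q := by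
    rw [hQ, sub_mul, mul_sub, one_mul, mul_one, hu.proj_comm' hd hβ]
  have hPβ' : P * βᴴ = βᴴ * P := (hu.proj_comm' hd hβ).symm
  -- Q intertwines C with iβ*, hence also their exponentials: on the range of Q the modified
  -- generator is the original one.
  have hQC : Q * C = (Complex.I • βᴴ) * Q := by
    rw [hCdef, stableGenerator, mul_sub, ← hP, hQP, sub_zero, Matrix.mul_smul, hQβ',
      Matrix.smul_mul]
  have hPC : P * C = C * P := by
    rw [hCdef, stableGenerator, mul_sub, sub_mul, ← hP, Matrix.mul_smul, hPβ', Matrix.smul_mul]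
  have hX : Q * Θ₂ - Q * Θ₁ = Δ := by
    rw [← Matrix.mul_sub, ← hΔ, hQ, Matrix.sub_mul, Matrix.one_mul, hPΔ, sub_zero]
  have ha : ∀ k, Θ₁ᴴ *ᵥ u k = Θ₂ᴴ *ᵥ u k := fun k => by
    have := hu.conjTranspose_mulVec_eq_zero hd hβ k
    rw [hΔ, Matrix.conjTranspose_sub, Matrix.sub_mulVec, sub_eq_zero] at this
    exact this.symm
  have hstar : ∀ (Θ : Matrix (Fin n) (Fin p) ℂ) k, star (u k) ᵥ* Θ = star (Θᴴ *ᵥ u k) :=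
    fun Θ k => by rw [Matrix.star_mulVec, Matrix.conjTranspose_conjTranspose]
  refine ⟨m, ev, fun k => Θ₂ᴴ *ᵥ u k, C, Q * Θ₁, Q * Θ₂, hC, fun s => ?_, fun w hw => ?_,
    fun z => ?_⟩
  · have h1 : Q * NormedSpace.exp ((s : ℂ) • C) =
        NormedSpace.exp ((Complex.I * (s : ℂ)) • βᴴ) * Q := by
      apply exp_mul_eq_of_mul_eq
      rw [Matrix.mul_smul, hQC, ← Matrix.smul_mul, smul_smul, mul_comm]
    set Y := NormedSpace.exp ((Complex.I * (s : ℂ)) • βᴴ)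
    have h2 : Y * P = ∑ k, Complex.exp (Complex.I * s * ev k) •
        Matrix.vecMulVec (u k) (star (u k)) := by
      rw [hP, mul_proj]
      refine Finset.sum_congr rfl fun k _ => ?_
      rw [exp_mulVec_of_eigenvector (μ := Complex.I * s * ev k), Matrix.smul_vecMulVec]
      rw [Matrix.smul_mulVec, conjTranspose_mulVec_eigenvector hβ
        (hu.conjTranspose_mulVec_eq_zero hd hβ k), hu.2, smul_smul]
    have h3 : Y = Y * Q + Y * P := by rw [← mul_add, hQ, sub_add_cancel, mul_one]
    rw [Matrix.conjTranspose_mul, hQh]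
    conv_lhs => rw [h3]
    rw [Matrix.mul_add, Matrix.add_mul]
    congr 1
    · rw [← hQQ, ← Matrix.mul_assoc Y, ← h1]
      simp only [← Matrix.mul_assoc]
      rw [Matrix.mul_assoc _ Q Q, hQQ, Matrix.mul_assoc _ Q Q, hQQ]
    · rw [h2, Matrix.mul_sum, Matrix.sum_mul]
      refine Finset.sum_congr rfl fun k _ => ?_
      rw [Matrix.mul_smul, Matrix.smul_mul, Matrix.mul_vecMulVec, Matrix.vecMulVec_mul, hstar, ha]
  · set F := (Complex.I * conj w) • (1 : Matrix (Fin n) (Fin n) ℂ) - C with hF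
    have hFu : IsUnit F.det := hC.isUnit_det (by simp [hw.le])
    have hFE : Fᴴ * F⁻¹ᴴ = 1 := by
      rw [← Matrix.conjTranspose_mul, Matrix.nonsing_inv_mul _ hFu, Matrix.conjTranspose_one]
    have hβu := isUnit_det_dissipative hd hβ hw
    set R := (β - w • (1 : Matrix (Fin n) (Fin n) ℂ))⁻¹
    have hR : R * (β - w • (1 : Matrix (Fin n) (Fin n) ℂ)) = 1 := Matrix.nonsing_inv_mul _ hβu
    -- The resolvent counterpart of `hQC`: up to the factor i, the resolvent of β on the range of Q
    -- is the adjoint of the resolvent of C at i times the conjugate of w.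
    have hQF : (β - w • (1 : Matrix (Fin n) (Fin n) ℂ)) * (Complex.I • Q) = Q * Fᴴ := by
      have e : Fᴴ = Complex.I • β + P - (Complex.I * w) • 1 := by
        rw [hF, Matrix.conjTranspose_sub, Matrix.conjTranspose_smul, Matrix.conjTranspose_one,
          hCdef, stableGenerator, Matrix.conjTranspose_sub, Matrix.conjTranspose_smul,
          Matrix.conjTranspose_conjTranspose, conjTranspose_proj]
        simp
        abel
      rw [e, mul_sub, mul_add, hQP, add_zero, Matrix.mul_smul, sub_mul, Matrix.mul_smul,
        Matrix.mul_smul Q, mul_one, Matrix.smul_mul, one_mul, hQβ, smul_sub, smul_smul]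
    have hRQ : R * Q = Complex.I • (Q * F⁻¹ᴴ) := by
      calc R * Q = R * (Q * Fᴴ * F⁻¹ᴴ) := by rw [Matrix.mul_assoc, hFE, mul_one]
        _ = (R * (β - w • (1 : Matrix (Fin n) (Fin n) ℂ))) * (Complex.I • Q) * F⁻¹ᴴ := by
          rw [← hQF]; simp only [Matrix.mul_assoc]
        _ = _ := by rw [hR, one_mul, Matrix.smul_mul]
    have h2 : R * P = ∑ k, ((ev k : ℂ) - w)⁻¹ • Matrix.vecMulVec (u k) (star (u k)) := by
      rw [hP, mul_proj]
      refine Finset.sum_congr rfl fun k _ => ?_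
      rw [← Matrix.smul_vecMulVec]
      congr 1
      have hne : (ev k : ℂ) - w ≠ 0 := fun h0 => by
        have := congrArg Complex.im h0
        simp at this
        exact hw.ne' this
      have h4 : (β - w • (1 : Matrix (Fin n) (Fin n) ℂ)) *ᵥ u k = ((ev k : ℂ) - w) • u k := by
        rw [Matrix.sub_mulVec, Matrix.smul_mulVec, Matrix.one_mulVec, hu.2, sub_smul]
      have h5 := congrArg (fun v => R *ᵥ v) h4
      simp only [Matrix.mulVec_mulVec, hR, Matrix.one_mulVec, Matrix.mulVec_smul] at h5
      conv_rhs => rw [h5, smul_smul, inv_mul_cancel₀ hne, one_smul]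
    have h3 : R = R * Q + R * P := by rw [← mul_add, hQ, sub_add_cancel, mul_one]
    conv_lhs => rw [h3]
    rw [Matrix.mul_add, Matrix.add_mul]
    congr 1
    · have hRQ' : R * Q = Complex.I • (Q * F⁻¹ᴴ) * Q := by rw [← hRQ, Matrix.mul_assoc, hQQ]
      rw [hRQ']
      simp only [Matrix.conjTranspose_mul, Matrix.conjTranspose_conjTranspose, hQh,
        Matrix.smul_mul, Matrix.mul_smul]
      simp only [← Matrix.mul_assoc]
    · rw [h2, Matrix.mul_sum, Matrix.sum_mul]
      refine Finset.sum_congr rfl fun k _ => ?_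
      rw [Matrix.mul_smul, Matrix.smul_mul, Matrix.mul_vecMulVec, Matrix.vecMulVec_mul, hstar, ha]
  · set F := (Complex.I * (z : ℂ)) • (1 : Matrix (Fin n) (Fin n) ℂ) - C with hF
    have hFu : IsUnit F.det := hC.isUnit_det (by simp)
    have hDu : diagD d * (diagD d)⁻¹ = 1 := by
      rw [diagD_inv hd, diagD, Matrix.diagonal_mul_diagonal, ← Matrix.diagonal_one]
      congr 1
      ext i
      exact mul_inv_cancel₀ (Complex.ofReal_ne_zero.2 (hd i).ne')
    refine density_factorization (P := P) (F := F) hDu ?_ (Matrix.nonsing_inv_mul _ hFu) ?_ ?_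
    · rw [diagD, Matrix.diagonal_conjTranspose]
      congr 1
      ext i
      simp
    · rw [hX]
      have := stableGenerator_add_conjTranspose (u := u) hβ
      have e : F + Fᴴ = -(C + Cᴴ) := by
        rw [hF, Matrix.conjTranspose_sub, Matrix.conjTranspose_smul, Matrix.conjTranspose_one]
        have : star (Complex.I * (z : ℂ)) = -(Complex.I * z) := by simp
        rw [this, neg_smul]
        abel
      rw [e, hCdef, this]
      abel
    -- P commutes with C, hence with F⁻¹, and X₂* ends in Q on its right; QP = 0 removes the
    -- artificial damping from the factorization.
    · have hPF : P * F = F * P := by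
        rw [hF, mul_sub, sub_mul, hPC, Matrix.mul_smul, Matrix.smul_mul, mul_one, one_mul]
      have hFP : F⁻¹ * P = P * F⁻¹ := by
        calc F⁻¹ * P = F⁻¹ * (P * F) * F⁻¹ := by
              rw [Matrix.mul_assoc, Matrix.mul_assoc, Matrix.mul_nonsing_inv _ hFu, mul_one]
          _ = P * F⁻¹ := by
              rw [hPF, ← Matrix.mul_assoc, Matrix.nonsing_inv_mul _ hFu, one_mul]
      rw [Matrix.mul_assoc, hFP, Matrix.conjTranspose_mul, hQh, Matrix.mul_assoc,
        ← Matrix.mul_assoc Q, hQP, Matrix.zero_mul, Matrix.mul_zero]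

end Realization

/-! ### Plancherel formulas under dilations -/

section Scaling

lemma integrable_rescale {f : ℝ → ℂ} (hf : Integrable f) {a : ℝ} (ha : 0 < a) :
    Integrable fun y => (a : ℂ)⁻¹ * f (a⁻¹ * y) :=
  (hf.comp_mul_left' (inv_pos.2 ha).ne').const_mul _

lemma memLp_rescale {f : ℝ → ℂ} (hf : Integrable f) (hf2 : MemLp f 2) {a : ℝ} (ha : 0 < a) :
    MemLp (fun y => (a : ℂ)⁻¹ * f (a⁻¹ * y)) 2 := by
  refine MemLp.const_mul ?_ _
  have h1 := (hf.comp_mul_left' (inv_pos.2 ha).ne').1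
  rw [memLp_two_iff_integrable_sq_norm h1]
  exact ((memLp_two_iff_integrable_sq_norm hf.1).1 hf2).comp_mul_left' (inv_pos.2 ha).ne'

lemma integral_mul_rescale (F f : ℝ → ℂ) {a : ℝ} (ha : 0 < a) :
    ∫ y, F y * ((a : ℂ)⁻¹ * f (a⁻¹ * y)) = ∫ x, F (a * x) * f x := by
  have h := Measure.integral_comp_mul_left (fun x => F (a * x) * ((a : ℂ)⁻¹ * f x)) a⁻¹
  have e : ∀ y, a * (a⁻¹ * y) = y := fun y => mul_inv_cancel_left₀ ha.ne' y
  simp only [e] at h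
  rw [h, inv_inv, abs_of_pos ha, ← integral_smul]
  congr 1
  ext x
  have : (a : ℂ) ≠ 0 := Complex.ofReal_ne_zero.2 ha.ne'
  rw [Complex.real_smul]
  field_simp

lemma ft_rescale (f : ℝ → ℂ) {a : ℝ} (ha : 0 < a) (z : ℝ) :
    ft (fun y => (a : ℂ)⁻¹ * f (a⁻¹ * y)) z = ft f (a * z) := by
  rw [ft, ft, integral_mul_rescale _ _ ha]
  congr 1
  ext x
  congr 3
  push_cast
  ring

lemma plancherel_scaled {g f : ℝ → ℂ} (hg : Integrable g) (hg2 : MemLp g 2) (hf : Integrable f)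
    (hf2 : MemLp f 2) {a : ℝ} (ha : 0 < a) :
    Integrable (fun z => conj (ft g (a * z)) * ft f (a * z)) ∧
    ∫ z, conj (ft g (a * z)) * ft f (a * z) = 2 * Real.pi * (a : ℂ)⁻¹ * ∫ s, conj (g s) * f s := by
  obtain ⟨h1, h2⟩ := plancherel hg hg2 hf hf2
  refine ⟨h1.comp_mul_left' ha.ne', ?_⟩
  rw [Measure.integral_comp_mul_left (fun z => conj (ft g z) * ft f z), h2,
    abs_of_pos (inv_pos.2 ha), Complex.real_smul]
  push_cast
  ring

/-- Substituting y = ax and bt for t turns the kernel h(ax - bt) into an honest convolution of the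
L¹-normalized dilates of `f` and `g`, whose transforms are dilated by b and a. -/
lemma parseval_convolution_scaled {g f h : ℝ → ℂ} (hg : Integrable g) (hg2 : MemLp g 2)
    (hf : Integrable f) (hh : Integrable h) {C : ℝ} (hC : ∀ s, ‖h s‖ ≤ C)
    {a b : ℝ} (ha : 0 < a) (hb : 0 < b) :
    Integrable (fun z => conj (ft g (a * z)) * (ft h z * ft f (b * z))) ∧
    ∫ z, conj (ft g (a * z)) * (ft h z * ft f (b * z)) =
      2 * Real.pi * ∫ x, conj (g x) * ∫ t, h (a * x - b * t) * f t := by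
  have key := parseval_convolution (integrable_rescale hf hb) (integrable_rescale hg ha)
    (memLp_rescale hg hg2 ha) hh hC
  simp only [ft_rescale _ ha, ft_rescale _ hb] at key
  refine ⟨key.1, key.2.trans ?_⟩
  congr 1
  simp_rw [integral_mul_rescale _ f hb]
  have := integral_mul_rescale (fun y => ∫ x, h (y - b * x) * f x) (fun x => conj (g x)) ha
  rw [show (fun x => conj (g x) * ∫ t, h (a * x - b * t) * f t) =
    fun x => (∫ t, h (a * x - b * t) * f t) * conj (g x) from funext fun x => mul_comm _ _, ← this]
  congr 1
  ext y
  rw [mul_comm, map_mul, map_inv₀, Complex.conj_ofReal]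

end Scaling

/-! ### Components of L²_p(0,l) and bounded integral operators -/

section Components

variable {p : ℕ} {l : ℝ}

/-- The `i`-th component of `f ∈ L²_p(0,l)`, extended by zero to the real line. -/
def comp (f : L2 p l) (i : Fin p) : ℝ → ℂ :=
  (Set.Ioo (0 : ℝ) l).indicator fun x => f x i

lemma memLp_component (f : L2 p l) (i : Fin p) :
    MemLp (fun x => f x i) 2 (volume.restrict (Set.Ioo (0 : ℝ) l)) :=
  (EuclideanSpace.proj (𝕜 := ℂ) i).comp_memLp' (Lp.memLp f)

lemma memLp_comp (f : L2 p l) (i : Fin p) : MemLp (comp f i) 2 :=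
  (memLp_indicator_iff_restrict measurableSet_Ioo).2 (memLp_component f i)

lemma integrable_component (f : L2 p l) (i : Fin p) :
    Integrable (fun x => f x i) (volume.restrict (Set.Ioo (0 : ℝ) l)) :=
  (memLp_component f i).integrable one_le_two

lemma integrable_comp (f : L2 p l) (i : Fin p) : Integrable (comp f i) :=
  (integrable_indicator_iff measurableSet_Ioo).2 (integrable_component f i)

lemma setIntegral_mul_component (F : ℝ → ℂ) (f : L2 p l) (i : Fin p) :
    ∫ x in Set.Ioo (0 : ℝ) l, F x * f x i = ∫ x, F x * comp f i x := by
  rw [← integral_indicator measurableSet_Ioo]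
  congr 1
  ext x
  by_cases hx : x ∈ Set.Ioo (0 : ℝ) l <;> simp [comp, hx]

lemma transform_eq_ft (d : Fin p → ℝ) (f : L2 p l) (z : ℝ) (i : Fin p) :
    transform d l f z i = ft (comp f i) (d i * z) := by
  rw [transform, setIntegral_mul_component, ft]
  congr 1
  ext x
  congr 3
  push_cast
  ring

lemma inner_eq_sum (g f : L2 p l) :
    inner ℂ g f = ∑ i, ∫ x in Set.Ioo (0 : ℝ) l, conj (g x i) * f x i := by
  rw [L2.inner_def, ← integral_finsetSum]
  · congr 1
    ext x
    rw [PiLp.inner_apply]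
    exact Finset.sum_congr rfl fun i _ => by rw [RCLike.inner_apply, mul_comm]
  · intro i _
    exact (memLp_component g i).star.integrable_mul (memLp_component f i)

/-- On the bounded interval the `L¹` norm is controlled by the `L²` norm. -/
lemma exists_integral_norm_le (p : ℕ) (l : ℝ) :
    ∃ c : ℝ, 0 ≤ c ∧ ∀ f : L2 p l, ∫ x in Set.Ioo (0 : ℝ) l, ‖f x‖ ≤ c * ‖f‖ := by
  set μ := volume.restrict (Set.Ioo (0 : ℝ) l) with hμ
  refine ⟨(μ Set.univ ^ (1 / (1 : ENNReal).toReal - 1 / (2 : ENNReal).toReal)).toReal,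
    ENNReal.toReal_nonneg, fun f => ?_⟩
  have h := eLpNorm_le_eLpNorm_mul_rpow_measure_univ (μ := μ) (f := f) one_le_two
    (Lp.aestronglyMeasurable f)
  have hfin : μ Set.univ ^ (1 / (1 : ENNReal).toReal - 1 / (2 : ENNReal).toReal) ≠ ⊤ :=
    ENNReal.rpow_ne_top_of_nonneg (by norm_num) (measure_ne_top _ _)
  have h2 := ENNReal.toReal_mono (ENNReal.mul_ne_top (Lp.eLpNorm_ne_top f) hfin) h
  rw [ENNReal.toReal_mul, ← Lp.norm_def] at h2
  rw [integral_norm_eq_lintegral_enorm (Lp.aestronglyMeasurable f), ← eLpNorm_one_eq_lintegral_enorm,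
    mul_comm]
  exact h2

lemma norm_apply_le (v : EuclideanSpace ℂ (Fin p)) (i : Fin p) : ‖v i‖ ≤ ‖v‖ :=
  PiLp.norm_apply_le v i

lemma integrable_norm_L2 (f : L2 p l) :
    Integrable (fun x => ‖f x‖) (volume.restrict (Set.Ioo (0 : ℝ) l)) :=
  ((Lp.memLp f).integrable one_le_two).norm

/-- Integral operators with bounded measurable kernels on a bounded interval are bounded. -/
lemma exists_integralOperator (K : Fin p → Fin p → ℝ → ℝ → ℂ)
    (hK : ∀ i j, Measurable (Function.uncurry (K i j))) {M : ℝ} (hM : ∀ i j x t, ‖K i j x t‖ ≤ M) :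
    ∃ T : L2 p l →L[ℂ] L2 p l, ∀ f : L2 p l,
      ∀ᵐ x ∂(volume.restrict (Set.Ioo (0 : ℝ) l)), ∀ i,
        T f x i = ∫ t in Set.Ioo (0 : ℝ) l, ∑ j, K i j x t * f t j := by
  set μ := volume.restrict (Set.Ioo (0 : ℝ) l) with hμ
  have hint : ∀ (f : L2 p l) i j x, Integrable (fun t => K i j x t * f t j) μ := by
    intro f i j x
    refine (integrable_component f j).bdd_mul (c := M) ?_ (ae_of_all _ fun t => hM i j x t)
    exact ((hK i j).comp measurable_prodMk_left).aestronglyMeasurable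
  set F : L2 p l → ℝ → EuclideanSpace ℂ (Fin p) := fun f x =>
    WithLp.toLp 2 fun i => ∫ t, ∑ j, K i j x t * f t j ∂μ with hF
  have hmeas : ∀ f, AEStronglyMeasurable (F f) μ := by
    intro f
    have hcomp : ∀ i, AEStronglyMeasurable (fun x => ∫ t, ∑ j, K i j x t * f t j ∂μ) μ := by
      intro i
      refine AEStronglyMeasurable.integral_prod_right'
        (f := fun q : ℝ × ℝ => ∑ j, K i j q.1 q.2 * f q.2 j) ?_
      refine Finset.aestronglyMeasurable_fun_sum _ fun j _ => ?_
      exact (hK i j).aestronglyMeasurable.mul (integrable_component f j).1.comp_snd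
    have h1 : AEStronglyMeasurable (fun x i => ∫ t, ∑ j, K i j x t * f t j ∂μ) μ :=
      (aemeasurable_pi_lambda _ fun i => (hcomp i).aemeasurable).aestronglyMeasurable
    exact (PiLp.continuous_toLp 2 _).comp_aestronglyMeasurable h1
  obtain ⟨c, hc, hcf⟩ := exists_integral_norm_le p l
  have hM0 : ∀ (_ : Fin p), 0 ≤ M := fun i => (norm_nonneg _).trans (hM i i 0 0)
  -- The image is bounded pointwise by the L¹ norm of `f`, hence by its L² norm; on a finite measure
  -- space this sup bound gives the operator bound.
  have hbound : ∀ f x, ‖F f x‖ ≤ ∑ _i : Fin p, ∑ _j : Fin p, M * (c * ‖f‖) := by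
    intro f x
    have h1 : ‖F f x‖ ≤ ∑ i, ‖F f x i‖ := by
      rw [EuclideanSpace.norm_eq]
      refine Real.sqrt_le_iff.2 ⟨Finset.sum_nonneg fun _ _ => norm_nonneg _, ?_⟩
      exact Finset.sum_sq_le_sq_sum_of_nonneg fun _ _ => norm_nonneg _
    refine h1.trans (Finset.sum_le_sum fun i _ => ?_)
    change ‖∫ t, ∑ j, K i j x t * f t j ∂μ‖ ≤ _
    rw [integral_finsetSum _ fun j _ => hint f i j x]
    refine (norm_sum_le _ _).trans (Finset.sum_le_sum fun j _ => ?_)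
    calc ‖∫ t, K i j x t * f t j ∂μ‖ ≤ ∫ t, M * ‖f t‖ ∂μ := by
          refine norm_integral_le_of_norm_le ((integrable_norm_L2 f).const_mul M)
            (ae_of_all _ fun t => ?_)
          rw [norm_mul]
          exact mul_le_mul (hM i j x t) (norm_apply_le _ _) (norm_nonneg _) (hM0 i)
      _ = M * ∫ t, ‖f t‖ ∂μ := integral_const_mul _ _
      _ ≤ M * (c * ‖f‖) := mul_le_mul_of_nonneg_left (hcf f) (hM0 i)
  have hmem : ∀ f, MemLp (F f) 2 μ := fun f => MemLp.of_bound (hmeas f) _ (ae_of_all _ (hbound f))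
  let T₀ : L2 p l →ₗ[ℂ] L2 p l :=
    { toFun := fun f => (hmem f).toLp (F f)
      map_add' := fun f g => by
        rw [← MemLp.toLp_add]
        refine MemLp.toLp_congr _ _ (ae_of_all _ fun x => ?_)
        ext i
        change ∫ t, ∑ j, K i j x t * (f + g) t j ∂μ =
          ∫ t, ∑ j, K i j x t * f t j ∂μ + ∫ t, ∑ j, K i j x t * g t j ∂μ
        rw [← integral_add (integrable_finsetSum _ fun j _ => hint f i j x)
          (integrable_finsetSum _ fun j _ => hint g i j x)]
        refine integral_congr_ae ?_
        filter_upwards [Lp.coeFn_add f g] with t ht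
        rw [ht, ← Finset.sum_add_distrib]
        exact Finset.sum_congr rfl fun j _ => mul_add _ _ _
      map_smul' := fun a f => by
        rw [RingHom.id_apply, ← MemLp.toLp_const_smul]
        refine MemLp.toLp_congr _ _ (ae_of_all _ fun x => ?_)
        ext i
        change ∫ t, ∑ j, K i j x t * (a • f) t j ∂μ = a * ∫ t, ∑ j, K i j x t * f t j ∂μ
        rw [← integral_const_mul]
        refine integral_congr_ae ?_
        filter_upwards [Lp.coeFn_smul a f] with t ht
        rw [ht, Finset.mul_sum]
        exact Finset.sum_congr rfl fun j _ => mul_left_comm _ _ _ }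
  refine ⟨T₀.mkContinuous ((measureUnivNNReal μ : ℝ) ^ (ENNReal.toReal 2)⁻¹ *
    ∑ _i : Fin p, ∑ _j : Fin p, M * c) fun f => ?_, fun f => ?_⟩
  · have h1 : ‖T₀ f‖ ≤ (measureUnivNNReal μ : ℝ) ^ (ENNReal.toReal 2)⁻¹ *
        ∑ _i : Fin p, ∑ _j : Fin p, M * (c * ‖f‖) := by
      refine Lp.norm_le_of_ae_bound ?_ ?_
      · exact Finset.sum_nonneg fun i _ => Finset.sum_nonneg fun _ _ =>
          mul_nonneg (hM0 i) (mul_nonneg hc (norm_nonneg _))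
      · filter_upwards [(hmem f).coeFn_toLp] with x hx
        change ‖(hmem f).toLp (F f) x‖ ≤ _
        rw [hx]
        exact hbound f x
    refine h1.trans (le_of_eq ?_)
    rw [mul_assoc, Finset.sum_mul]
    congr 1
    refine Finset.sum_congr rfl fun i _ => ?_
    rw [Finset.sum_mul]
    exact Finset.sum_congr rfl fun j _ => (mul_assoc _ _ _).symm
  · filter_upwards [(hmem f).coeFn_toLp] with x hx i
    change (hmem f).toLp (F f) x i = _
    rw [hx]

end Components

/-! ### The sesquilinear form of S in terms of transforms -/

section Spectral

variable {p : ℕ} {l : ℝ}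

/-- The absolutely continuous spectral density with Fourier data `κ`. -/
def spectralDensity (d : Fin p → ℝ) (κ : Fin p → Fin p → ℝ → ℂ) (z : ℝ) :
    Matrix (Fin p) (Fin p) ℂ :=
  Matrix.of fun i j => (2 * Real.pi : ℂ)⁻¹ * (diagD d i j + ft (κ i j) z)

lemma two_pi_ne_zero' : (2 * Real.pi : ℂ) ≠ 0 := by
  exact_mod_cast (by positivity : (2 * Real.pi : ℝ) ≠ 0)

lemma star_dotProduct_mulVec_eq (A : Matrix (Fin p) (Fin p) ℂ) (y x : Fin p → ℂ) :
    star y ⬝ᵥ (A *ᵥ x) = ∑ i, ∑ j, conj (y i) * (A i j * x j) := by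
  simp only [dotProduct, Matrix.mulVec, Finset.mul_sum]
  rfl

/-- The D-term of the density yields exactly the L² inner product, since d_i cancels the Jacobian of
z ↦ d_i z in Plancherel's formula; the κ-term yields the integral operator. -/
lemma integral_spectralDensity {d : Fin p → ℝ} (hd : ∀ i, 0 < d i)
    {κ : Fin p → Fin p → ℝ → ℂ} (hκ : ∀ i j, Integrable (κ i j)) {M : ℝ}
    (hM : ∀ i j s, ‖κ i j s‖ ≤ M) (g f : L2 p l) :
    Integrable (fun z => star (transform d l g z) ⬝ᵥ
      (spectralDensity d κ z *ᵥ transform d l f z)) ∧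
    ∫ z, star (transform d l g z) ⬝ᵥ (spectralDensity d κ z *ᵥ transform d l f z) =
      ∑ i, ((∫ x, conj (comp g i x) * comp f i x) + ∑ j, ∫ x, conj (comp g i x) *
        ∫ t, κ i j (d i * x - d j * t) * comp f j t) := by
  have h1 := fun i => plancherel_scaled (integrable_comp g i) (memLp_comp g i)
    (integrable_comp f i) (memLp_comp f i) (hd i)
  have h2 := fun i j => parseval_convolution_scaled (integrable_comp g i) (memLp_comp g i)
    (integrable_comp f j) (hκ i j) (hM i j) (hd i) (hd j)
  have e : (fun z => star (transform d l g z) ⬝ᵥ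
      (spectralDensity d κ z *ᵥ transform d l f z)) = fun z => (2 * Real.pi : ℂ)⁻¹ * ∑ i,
        ((d i : ℂ) * (conj (ft (comp g i) (d i * z)) * ft (comp f i) (d i * z)) +
        ∑ j, conj (ft (comp g i) (d i * z)) * (ft (κ i j) z * ft (comp f j) (d j * z))) := by
    ext z
    rw [star_dotProduct_mulVec_eq, Finset.mul_sum]
    refine Finset.sum_congr rfl fun i _ => ?_
    simp only [transform_eq_ft, spectralDensity, Matrix.of_apply]
    have : (d i : ℂ) * (conj (ft (comp g i) (d i * z)) * ft (comp f i) (d i * z)) =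
        ∑ j, conj (ft (comp g i) (d i * z)) * (diagD d i j * ft (comp f j) (d j * z)) := by
      rw [Finset.sum_eq_single i]
      · rw [diagD, Matrix.diagonal_apply_eq]; ring
      · intro j _ hj
        rw [diagD, Matrix.diagonal_apply_ne' _ hj]; ring
      · simp
    rw [this, ← Finset.sum_add_distrib, Finset.mul_sum]
    refine Finset.sum_congr rfl fun j _ => ?_
    ring
  rw [e]
  have i1 : ∀ i, Integrable (fun z => (d i : ℂ) * (conj (ft (comp g i) (d i * z)) *
      ft (comp f i) (d i * z))) := fun i => (h1 i).1.const_mul _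
  have i2 : ∀ i, Integrable (fun z => ∑ j, conj (ft (comp g i) (d i * z)) *
      (ft (κ i j) z * ft (comp f j) (d j * z))) := fun i =>
    integrable_finsetSum _ fun j _ => (h2 i j).1
  have i3 : ∀ i, Integrable (fun z => (d i : ℂ) * (conj (ft (comp g i) (d i * z)) *
      ft (comp f i) (d i * z)) + ∑ j, conj (ft (comp g i) (d i * z)) *
      (ft (κ i j) z * ft (comp f j) (d j * z))) := fun i => (i1 i).add (i2 i)
  refine ⟨(integrable_finsetSum _ fun i _ => i3 i).const_mul _, ?_⟩
  rw [integral_const_mul, integral_finsetSum _ fun i _ => i3 i, Finset.mul_sum]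
  refine Finset.sum_congr rfl fun i _ => ?_
  rw [integral_add (i1 i) (i2 i), integral_const_mul, (h1 i).2,
    integral_finsetSum _ fun j _ => (h2 i j).1, mul_add, Finset.mul_sum]
  have hdi : (d i : ℂ) ≠ 0 := Complex.ofReal_ne_zero.2 (hd i).ne'
  have hpi := two_pi_ne_zero'
  congr 1
  · field_simp
  · refine Finset.sum_congr rfl fun j _ => ?_
    rw [(h2 i j).2, inv_mul_cancel_left₀ hpi]

lemma integrable_conj_comp (g : L2 p l) (i : Fin p) :
    Integrable fun x => conj (comp g i x) :=
  memLp_one_iff_integrable.1 (memLp_one_iff_integrable.2 (integrable_comp g i)).star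

lemma integrable_mul_kernel_integral {d : Fin p → ℝ} {h : ℝ → ℂ} (hm : Measurable h) {M : ℝ}
    (hM : ∀ s, ‖h s‖ ≤ M) (g f : L2 p l) (i j : Fin p) :
    Integrable fun x => conj (comp g i x) * ∫ t, h (d i * x - d j * t) * comp f j t := by
  have hg := integrable_conj_comp g i
  refine hg.mul_bdd (c := M * ∫ t, ‖comp f j t‖) ?_ (ae_of_all _ fun x => ?_)
  · refine AEStronglyMeasurable.integral_prod_right'
      (f := fun q : ℝ × ℝ => h (d i * q.1 - d j * q.2) * comp f j q.2) ?_
    exact (hm.comp (by fun_prop)).aestronglyMeasurable.mul (integrable_comp f j).1.comp_snd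
  · rw [← integral_const_mul]
    refine norm_integral_le_of_norm_le ((integrable_comp f j).norm.const_mul M)
      (ae_of_all _ fun t => ?_)
    rw [norm_mul]
    exact mul_le_mul_of_nonneg_right (hM _) (norm_nonneg _)

lemma integrable_kernel_mul {h : ℝ → ℂ} (hm : Measurable h) {M : ℝ}
    (hM : ∀ s, ‖h s‖ ≤ M) (f : L2 p l) (j : Fin p) (a b : ℝ) :
    Integrable fun t => h (a - b * t) * comp f j t := by
  refine (integrable_comp f j).bdd_mul (c := M) ?_ (ae_of_all _ fun t => hM _)
  exact (hm.comp (by fun_prop)).aestronglyMeasurable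

lemma integral_star_comp_mul_exp (d : Fin p → ℝ) (g : L2 p l) (i : Fin p) (z : ℝ) :
    ∫ x, conj (comp g i x) * Complex.exp (Complex.I * (d i * x : ℝ) * z) =
      conj (transform d l g z i) := by
  rw [transform_eq_ft, ft, ← integral_conj]
  congr 1
  ext x
  rw [map_mul, mul_comm, ← Complex.exp_conj]
  congr 2
  simp
  ring

/-- The quadratic form of the operator with kernel `κ` plus a trigonometric sum. -/
lemma inner_eq_spectral {d : Fin p → ℝ} (hd : ∀ i, 0 < d i)
    {κ : Fin p → Fin p → ℝ → ℂ} (hκ : ∀ i j, Integrable (κ i j)) (hκm : ∀ i j, Measurable (κ i j))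
    {M : ℝ} (hM : ∀ i j s, ‖κ i j s‖ ≤ M) {m : ℕ} (ev : Fin m → ℝ) (a : Fin m → Fin p → ℂ)
    {k : ℝ → Matrix (Fin p) (Fin p) ℂ} (hk : ∀ s, s ≠ 0 → ∀ i j, k s i j = κ i j s +
      ∑ r, Complex.exp (Complex.I * s * ev r) * Matrix.vecMulVec (a r) (star (a r)) i j)
    {S : L2 p l →L[ℂ] L2 p l} (hS : IsDDifferenceOperator d l k S) (g f : L2 p l) :
    inner ℂ g (S f) =
      (∫ z, star (transform d l g z) ⬝ᵥ (spectralDensity d κ z *ᵥ transform d l f z)) +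
      ∑ r, star (transform d l g (ev r)) ⬝ᵥ
        (Matrix.vecMulVec (a r) (star (a r)) *ᵥ transform d l f (ev r)) := by
  have hexp : ∀ (c : ℝ) (b z : ℝ) j, Integrable fun t =>
      Complex.exp (Complex.I * (c - b * t : ℝ) * z) * comp f j t := fun c b z j =>
    integrable_kernel_mul (h := fun s => Complex.exp (Complex.I * s * z)) (M := 1)
      (by fun_prop) (fun s => by rw [Complex.norm_exp]; simp) f j c b
  have hK : ∀ i x, (∫ t in Set.Ioo (0 : ℝ) l, ∑ j, k (d i * x - d j * t) i j * f t j) =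
      ∑ j, ((∫ t, κ i j (d i * x - d j * t) * comp f j t) +
        ∑ r, Complex.exp (Complex.I * (d i * x : ℝ) * ev r) *
          (Matrix.vecMulVec (a r) (star (a r)) i j * transform d l f (ev r) j)) := by
    intro i x
    have hae : ∀ j, (fun t => k (d i * x - d j * t) i j * comp f j t) =ᵐ[volume]
        fun t => κ i j (d i * x - d j * t) * comp f j t +
        ∑ r, Matrix.vecMulVec (a r) (star (a r)) i j *
          (Complex.exp (Complex.I * (d i * x - d j * t : ℝ) * ev r) * comp f j t) := by
      intro j
      -- The argument d_i x - d_j t vanishes at this single t, where nothing is assumed on the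
      -- kernel.
      have : ∀ᵐ t : ℝ, t ≠ (d j)⁻¹ * (d i * x) := Measure.ae_ne volume _
      filter_upwards [this] with t ht
      rw [hk _ (fun h0 => ht ?_), add_mul, Finset.sum_mul]
      · congr 1
        exact Finset.sum_congr rfl fun r _ => by ring
      · rw [eq_inv_mul_iff_mul_eq₀ (hd j).ne']; linarith
    have hi1 : ∀ j, Integrable fun t => κ i j (d i * x - d j * t) * comp f j t := fun j =>
      integrable_kernel_mul (hκm i j) (hM i j) f j _ _
    have hi2 : ∀ j, Integrable fun t => ∑ r, Matrix.vecMulVec (a r) (star (a r)) i j *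
          (Complex.exp (Complex.I * (d i * x - d j * t : ℝ) * ev r) * comp f j t) := fun j =>
      integrable_finsetSum _ fun r _ => (hexp _ _ _ _).const_mul _
    have hi : ∀ j, Integrable (fun t => k (d i * x - d j * t) i j * comp f j t) := fun j =>
      ((hi1 j).add (hi2 j)).congr (hae j).symm
    rw [← integral_indicator measurableSet_Ioo]
    have e : (Set.Ioo (0 : ℝ) l).indicator
        (fun t => ∑ j, k (d i * x - d j * t) i j * f t j) =
        fun t => ∑ j, k (d i * x - d j * t) i j * comp f j t := by
      ext t
      by_cases ht : t ∈ Set.Ioo (0 : ℝ) l <;> simp [comp, ht]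
    rw [e, integral_finsetSum _ fun j _ => hi j]
    refine Finset.sum_congr rfl fun j _ => ?_
    rw [integral_congr_ae (hae j), integral_add (hi1 j) (hi2 j),
      integral_finsetSum _ fun r _ => (hexp _ _ _ _).const_mul _]
    congr 1
    refine Finset.sum_congr rfl fun r _ => ?_
    rw [integral_const_mul, mul_left_comm]
    congr 1
    rw [transform_eq_ft, ft, ← integral_const_mul]
    congr 1
    ext t
    -- An exponential of d_i x - d_j t separates into functions of x and of t, so each trigonometric
    -- term reduces to transforms evaluated at `ev r`.
    rw [← mul_assoc, ← Complex.exp_add]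
    congr 2
    push_cast
    ring
  rw [(integral_spectralDensity hd hκ hM g f).2, inner_eq_sum]
  have hj1 : ∀ i, Integrable fun x => conj (comp g i x) * comp f i x := fun i =>
    (memLp_comp g i).star.integrable_mul (memLp_comp f i)
  have hj2 : ∀ i j, Integrable fun x => conj (comp g i x) *
      ∫ t, κ i j (d i * x - d j * t) * comp f j t := fun i j =>
    integrable_mul_kernel_integral (hκm i j) (hM i j) g f i j
  have hj3 : ∀ i r, Integrable fun x => conj (comp g i x) *
      Complex.exp (Complex.I * (d i * x : ℝ) * ev r) := fun i r => by
    have hg := integrable_conj_comp g i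
    refine hg.mul_bdd (c := 1) (by fun_prop) (ae_of_all _ fun x => ?_)
    rw [Complex.norm_exp]
    simp
  have hterm : ∀ i, ∫ x in Set.Ioo (0 : ℝ) l, conj (g x i) * S f x i =
      (∫ x, conj (comp g i x) * comp f i x) + ∑ j, ((∫ x, conj (comp g i x) *
        ∫ t, κ i j (d i * x - d j * t) * comp f j t) + ∑ r, conj (transform d l g (ev r) i) *
          (Matrix.vecMulVec (a r) (star (a r)) i j * transform d l f (ev r) j)) := by
    intro i
    have e1 : ∫ x in Set.Ioo (0 : ℝ) l, conj (g x i) * S f x i =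
        ∫ x, (conj (comp g i x) * comp f i x + ∑ j, (conj (comp g i x) *
        (∫ t, κ i j (d i * x - d j * t) * comp f j t) +
          ∑ r, (conj (comp g i x) * Complex.exp (Complex.I * (d i * x : ℝ) * ev r)) *
          (Matrix.vecMulVec (a r) (star (a r)) i j * transform d l f (ev r) j))) := by
      rw [← integral_indicator measurableSet_Ioo]
      refine integral_congr_ae ?_
      have := (ae_restrict_iff' measurableSet_Ioo).1 (hS f)
      filter_upwards [this] with x hx
      by_cases hxl : x ∈ Set.Ioo (0 : ℝ) l
      · rw [Set.indicator_of_mem hxl, hx hxl i, hK i x]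
        simp only [comp, Set.indicator_of_mem hxl, mul_add, Finset.mul_sum, mul_assoc]
      · simp [comp, hxl]
    rw [e1]
    have hj4 : ∀ j, Integrable fun x => ∑ r, (conj (comp g i x) *
        Complex.exp (Complex.I * (d i * x : ℝ) * ev r)) *
          (Matrix.vecMulVec (a r) (star (a r)) i j * transform d l f (ev r) j) := fun j =>
      integrable_finsetSum _ fun r _ => (hj3 i r).mul_const _
    have hj5 : ∀ j, Integrable fun x => conj (comp g i x) *
        (∫ t, κ i j (d i * x - d j * t) * comp f j t) +
          ∑ r, (conj (comp g i x) * Complex.exp (Complex.I * (d i * x : ℝ) * ev r)) *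
          (Matrix.vecMulVec (a r) (star (a r)) i j * transform d l f (ev r) j) := fun j =>
      (hj2 i j).add (hj4 j)
    rw [integral_add (hj1 i) (integrable_finsetSum _ fun j _ => hj5 j),
      integral_finsetSum _ fun j _ => hj5 j]
    congr 1
    refine Finset.sum_congr rfl fun j _ => ?_
    rw [integral_add (hj2 i j) (hj4 j), integral_finsetSum _ fun r _ => (hj3 i r).mul_const _]
    congr 1
    refine Finset.sum_congr rfl fun r _ => ?_
    rw [integral_mul_const, integral_star_comp_mul_exp]
  rw [Finset.sum_congr rfl fun i _ => hterm i]
  simp only [star_dotProduct_mulVec_eq, Finset.sum_add_distrib, add_assoc]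
  congr 2
  conv_rhs => rw [Finset.sum_comm]
  refine Finset.sum_congr rfl fun i _ => ?_
  rw [Finset.sum_comm]

end Spectral

/-! ### Matrix measures with a density and finitely many atoms -/

section Measure

variable {p m : ℕ}

open Classical in
/-- The matrix measure with an absolutely continuous part and finitely many atoms. -/
def spectralMeasure (ρ : ℝ → Matrix (Fin p) (Fin p) ℂ)
    (hρm : ∀ i j, Measurable fun z => ρ z i j) (hρ : ∀ z, (ρ z).PosSemidef)
    (ev : Fin m → ℝ) (a : Fin m → Fin p → ℂ) : MatrixMeasure p where
  -- Equal eigenvalues share one Dirac mass, so the base sums over the image of `ev` and the density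
  -- collects the whole fibre. Overwriting `ρ` there changes it only on a Lebesgue null set.
  base := volume + ∑ z ∈ Finset.univ.image ev, Measure.dirac z
  density z := if z ∈ Finset.univ.image ev then
    ∑ r with ev r = z, Matrix.vecMulVec (a r) (star (a r)) else ρ z
  measurable_density i j := by
    classical
    have hfin : Measurable fun z : ℝ =>
        (∑ r with ev r = z, Matrix.vecMulVec (a r) (star (a r))) i j := by
      have : ∀ z : ℝ, (∑ r with ev r = z, Matrix.vecMulVec (a r) (star (a r))) i j =
          ∑ r, if z ∈ ({ev r} : Set ℝ) then Matrix.vecMulVec (a r) (star (a r)) i j else 0 := by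
        intro z
        rw [Matrix.sum_apply, Finset.sum_filter]
        refine Finset.sum_congr rfl fun r _ => ?_
        by_cases h : ev r = z
        · simp [h]
        · simp [h, Ne.symm h]
      simp only [this]
      exact Finset.measurable_fun_sum _ fun r _ =>
        Measurable.ite (measurableSet_singleton _) measurable_const measurable_const
    have e : ∀ z, (if z ∈ Finset.univ.image ev then
        ∑ r with ev r = z, Matrix.vecMulVec (a r) (star (a r)) else ρ z) i j =
        if z ∈ Finset.univ.image ev then
          (∑ r with ev r = z, Matrix.vecMulVec (a r) (star (a r))) i j else ρ z i j := fun z => by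
      split_ifs <;> rfl
    simp only [e]
    exact Measurable.ite (Finset.univ.image ev).measurableSet hfin (hρm i j)
  posSemidef_density z := by
    split_ifs
    · exact Matrix.posSemidef_sum _ fun r _ => Matrix.posSemidef_vecMulVec_self_star _
    · exact hρ z

/-- The general linear functional `φ z` lets one formula serve the convergence condition, the
Herglotz integral and the form of S. -/
lemma integral_spectralMeasure (ρ : ℝ → Matrix (Fin p) (Fin p) ℂ)
    (hρm : ∀ i j, Measurable fun z => ρ z i j) (hρ : ∀ z, (ρ z).PosSemidef)
    (ev : Fin m → ℝ) (a : Fin m → Fin p → ℂ) (φ : ℝ → Matrix (Fin p) (Fin p) ℂ →ₗ[ℂ] ℂ)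
    (hφ : Integrable fun z => φ z (ρ z)) :
    Integrable (fun z => φ z ((spectralMeasure ρ hρm hρ ev a).density z))
      (spectralMeasure ρ hρm hρ ev a).base ∧
    ∫ z, φ z ((spectralMeasure ρ hρm hρ ev a).density z)
      ∂(spectralMeasure ρ hρm hρ ev a).base =
      (∫ z, φ z (ρ z)) + ∑ r, φ (ev r) (Matrix.vecMulVec (a r) (star (a r))) := by
  classical
  set τ := spectralMeasure ρ hρm hρ ev a with hτ
  have hbase : τ.base = volume + ∑ z ∈ Finset.univ.image ev, Measure.dirac z := by
    rw [hτ]; simp only [spectralMeasure]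
  have hdens : ∀ z, τ.density z = if z ∈ Finset.univ.image ev then
      ∑ r with ev r = z, Matrix.vecMulVec (a r) (star (a r)) else ρ z := by
    intro z
    rw [hτ]; simp only [spectralMeasure]
  have hae : (fun z => φ z (ρ z)) =ᵐ[volume] fun z => φ z (τ.density z) := by
    have : ∀ᵐ z : ℝ, z ∉ (Finset.univ.image ev : Set ℝ) :=
      (Finset.univ.image ev).finite_toSet.countable.ae_notMem _
    filter_upwards [this] with z hz
    rw [hdens, if_neg (by simpa using hz)]
  have h1 : Integrable (fun z => φ z (τ.density z)) volume := hφ.congr hae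
  have h2 : ∀ y ∈ Finset.univ.image ev,
      Integrable (fun z => φ z (τ.density z)) (Measure.dirac y) := fun y _ =>
    integrable_dirac (by simp)
  have h3 : Integrable (fun z => φ z (τ.density z))
      (∑ z ∈ Finset.univ.image ev, Measure.dirac z) := integrable_finsetSum_measure.2 h2
  rw [hbase]
  refine ⟨h1.add_measure h3, ?_⟩
  rw [integral_add_measure h1 h3, integral_congr_ae hae.symm, integral_finsetSum_measure h2]
  congr 1
  simp only [integral_dirac]
  rw [← Finset.sum_fiberwise_of_maps_to (g := ev) (t := Finset.univ.image ev)
    (fun r _ => Finset.mem_image_of_mem ev (Finset.mem_univ r))]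
  refine Finset.sum_congr rfl fun y hy => ?_
  rw [hdens, if_pos hy, map_sum]
  refine Finset.sum_congr rfl fun r hr => ?_
  rw [(Finset.mem_filter.1 hr).2]

end Measure

/-! ### Cauchy integrals and the Herglotz representation -/

section Herglotz

/-- The anticausal exponential whose Fourier transform is a Cauchy kernel. -/
def anticausalExp (w : ℂ) (s : ℝ) : ℂ := if s ≤ 0 then Complex.exp (Complex.I * conj w * s) else 0

lemma anticausalExp_eq_indicator (w : ℂ) : anticausalExp w =
    (Set.Iic 0).indicator fun s : ℝ => Complex.exp (Complex.I * conj w * s) := by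
  ext s; simp [anticausalExp, Set.indicator_apply]

lemma integrable_anticausalExp {w : ℂ} (hw : 0 < w.im) : Integrable (anticausalExp w) := by
  rw [anticausalExp_eq_indicator, integrable_indicator_iff measurableSet_Iic]
  exact integrableOn_exp_mul_complex_Iic (by simpa using hw) 0

lemma norm_anticausalExp_le {w : ℂ} (hw : 0 < w.im) (s : ℝ) : ‖anticausalExp w s‖ ≤ 1 := by
  unfold anticausalExp
  split_ifs with hs
  · rw [Complex.norm_exp]
    refine Real.exp_le_one_iff.2 ?_
    simp
    nlinarith
  · simp

lemma sub_ne_zero_of_im_pos {w : ℂ} (hw : 0 < w.im) (z : ℝ) : (z : ℂ) - w ≠ 0 := fun h => by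
  have := congrArg Complex.im h
  simp at this
  exact hw.ne' this

lemma conj_ft_anticausalExp {w : ℂ} (hw : 0 < w.im) (z : ℝ) :
    conj (ft (anticausalExp w) z) = -Complex.I * ((z : ℂ) - w)⁻¹ := by
  have h1 : ft (anticausalExp w) z =
      ∫ s in Set.Iic (0 : ℝ), Complex.exp ((Complex.I * (conj w - z)) * s) := by
    rw [ft, ← integral_indicator measurableSet_Iic]
    congr 1
    ext s
    by_cases hs : s ≤ 0
    · simp only [anticausalExp, hs, if_true, Set.mem_Iic, Set.indicator_of_mem, ← Complex.exp_add]
      congr 1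
      ring
    · simp [anticausalExp, hs]
  rw [h1, integral_exp_mul_complex_Iic (by simpa using hw)]
  have h2 := sub_ne_zero_of_im_pos hw z
  simp only [Complex.ofReal_zero, mul_zero, Complex.exp_zero, map_div₀, map_one, map_mul, map_sub,
    Complex.conj_conj, Complex.conj_I, Complex.conj_ofReal]
  have h3 : w - (z : ℂ) ≠ 0 := fun h => h2 (by rw [← neg_sub, h, neg_zero])
  have hI := Complex.I_ne_zero
  field_simp
  rw [Complex.I_sq]
  ring

/-- The Cauchy integral of the Fourier transform of a bounded integrable function. -/
lemma cauchy_integral_ft {κ : ℝ → ℂ} (hκ : Integrable κ) {M : ℝ} (hM : ∀ s, ‖κ s‖ ≤ M) {w : ℂ}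
    (hw : 0 < w.im) :
    Integrable (fun z : ℝ => ((z : ℂ) - w)⁻¹ * ft κ z) ∧
    ∫ z : ℝ, ((z : ℂ) - w)⁻¹ * ft κ z =
      2 * Real.pi * Complex.I * ∫ s, conj (anticausalExp w s) * κ s := by
  obtain ⟨h1, h2⟩ := plancherel (integrable_anticausalExp hw)
    (memLp_two_of_bound (integrable_anticausalExp hw) (norm_anticausalExp_le hw)) hκ
    (memLp_two_of_bound hκ hM)
  -- The Cauchy kernel is i times a conjugated Fourier transform, so the Cauchy integral is a
  -- Plancherel pairing.
  have e : ∀ z : ℝ, ((z : ℂ) - w)⁻¹ * ft κ z =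
      Complex.I * (conj (ft (anticausalExp w) z) * ft κ z) := fun z => by
    rw [conj_ft_anticausalExp hw, ← mul_assoc, ← mul_assoc, mul_neg, Complex.I_mul_I]
    ring
  simp only [e]
  refine ⟨h1.const_mul _, ?_⟩
  rw [integral_const_mul, h2]
  ring

lemma one_add_sq_ne_zero (z : ℝ) : (1 + (z : ℂ) ^ 2) ≠ 0 := by
  exact_mod_cast (by positivity : (1 + z ^ 2 : ℝ) ≠ 0)

lemma inv_one_add_sq_eq (z : ℝ) : (1 + (z : ℂ) ^ 2)⁻¹ = (((1 + z ^ 2)⁻¹ : ℝ) : ℂ) := by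
  push_cast; rfl

/-- The Herglotz counterterm is a Cauchy kernel at w = i up to an absolutely integrable term. -/
lemma div_one_add_sq_eq (z : ℝ) : (z : ℂ) / (1 + (z : ℂ) ^ 2) =
    ((z : ℂ) - Complex.I)⁻¹ - Complex.I * (1 + (z : ℂ) ^ 2)⁻¹ := by
  have h1 := one_add_sq_ne_zero z
  have h2 := sub_ne_zero_of_im_pos (w := Complex.I) (by simp) z
  rw [div_eq_mul_inv]
  field_simp
  ring_nf
  rw [Complex.I_sq]
  ring

lemma integrable_inv_one_add_sq_complex : Integrable fun z : ℝ => (1 + (z : ℂ) ^ 2)⁻¹ := by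
  simp only [inv_one_add_sq_eq]
  exact integrable_inv_one_add_sq.ofReal

lemma integrable_inv_one_add_sq_mul_ft {κ : ℝ → ℂ} (hκ : Integrable κ) :
    Integrable fun z : ℝ => (1 + (z : ℂ) ^ 2)⁻¹ * ft κ z :=
  integrable_inv_one_add_sq_complex.mul_bdd (continuous_ft hκ).aestronglyMeasurable
    (ae_of_all _ (norm_ft_le κ))

lemma integrable_div_one_add_sq_mul_ft {κ : ℝ → ℂ} (hκ : Integrable κ) {M : ℝ}
    (hM : ∀ s, ‖κ s‖ ≤ M) :
    Integrable fun z : ℝ => (z : ℂ) / (1 + (z : ℂ) ^ 2) * ft κ z := by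
  have e : ∀ z : ℝ, (z : ℂ) / (1 + (z : ℂ) ^ 2) * ft κ z =
      ((z : ℂ) - Complex.I)⁻¹ * ft κ z - Complex.I * ((1 + (z : ℂ) ^ 2)⁻¹ * ft κ z) := fun z => by
    rw [div_one_add_sq_eq]; ring
  simp only [e]
  exact (cauchy_integral_ft hκ hM (by simp)).1.sub
    ((integrable_inv_one_add_sq_mul_ft hκ).const_mul _)

/-- The Herglotz integral of Lebesgue measure. -/
lemma herglotz_integral_volume {w : ℂ} (hw : 0 < w.im) :
    Integrable (fun z : ℝ => ((z : ℂ) - w)⁻¹ - (z : ℂ) / (1 + (z : ℂ) ^ 2)) ∧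
    ∫ z : ℝ, (((z : ℂ) - w)⁻¹ - (z : ℂ) / (1 + (z : ℂ) ^ 2)) = Complex.I * Real.pi := by
  -- The transform of this one-sided exponential is -i/(z - i), so products of two Cauchy kernels
  -- become Cauchy integrals of a transform.
  set v : ℝ → ℂ := (Set.Ioi (0 : ℝ)).indicator fun s => Complex.exp (-1 * s) with hv
  have hvi : Integrable v := by
    rw [hv, integrable_indicator_iff measurableSet_Ioi]
    exact integrableOn_exp_mul_complex_Ioi (by simp) 0
  have hvb : ∀ s, ‖v s‖ ≤ 1 := fun s => by
    rw [hv]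
    by_cases hs : s ∈ Set.Ioi (0 : ℝ)
    · rw [Set.indicator_of_mem hs, Complex.norm_exp]
      have : 0 < s := hs
      refine Real.exp_le_one_iff.2 ?_
      simp
      exact this.le
    · rw [Set.indicator_of_notMem hs]; simp
  have hft : ∀ z : ℝ, ft v z = -Complex.I * ((z : ℂ) - Complex.I)⁻¹ := fun z => by
    have h1 : ft v z = ∫ s in Set.Ioi (0 : ℝ), Complex.exp ((-1 - Complex.I * z) * s) := by
      rw [ft, ← integral_indicator measurableSet_Ioi]
      congr 1
      ext s
      by_cases hs : s ∈ Set.Ioi (0 : ℝ)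
      · rw [hv, Set.indicator_of_mem hs, Set.indicator_of_mem hs, ← Complex.exp_add]
        congr 1
        ring
      · rw [hv, Set.indicator_of_notMem hs, Set.indicator_of_notMem hs, mul_zero]
    rw [h1, integral_exp_mul_complex_Ioi (by simp)]
    have h2 := sub_ne_zero_of_im_pos (w := Complex.I) (by simp) z
    have h3 : (-1 - Complex.I * (z : ℂ)) = -(Complex.I * ((z : ℂ) - Complex.I)) := by
      rw [mul_sub, Complex.I_mul_I]; ring
    rw [h3]
    simp only [Complex.ofReal_zero, mul_zero, Complex.exp_zero, neg_div_neg_eq]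
    have hI := Complex.I_ne_zero
    field_simp
    rw [Complex.I_sq]
    ring
  obtain ⟨h1, h2⟩ := cauchy_integral_ft hvi hvb hw
  -- The supports s ≤ 0 and s > 0 are disjoint, so the Cauchy integral of `ft v` vanishes; only i/(1
  -- + z²) contributes, with integral iπ.
  have h0 : ∀ s, conj (anticausalExp w s) * v s = 0 := fun s => by
    by_cases hs : s ∈ Set.Ioi (0 : ℝ)
    · have : ¬ s ≤ 0 := not_le.2 hs
      simp [anticausalExp, this]
    · rw [hv, Set.indicator_of_notMem hs, mul_zero]
  simp only [h0, integral_zero, mul_zero] at h2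
  have e : ∀ z : ℝ, ((z : ℂ) - w)⁻¹ - (z : ℂ) / (1 + (z : ℂ) ^ 2) =
      (w - Complex.I) * Complex.I * (((z : ℂ) - w)⁻¹ * ft v z) +
        Complex.I * (1 + (z : ℂ) ^ 2)⁻¹ := fun z => by
    have h3 := sub_ne_zero_of_im_pos hw z
    have h4 := sub_ne_zero_of_im_pos (w := Complex.I) (by simp) z
    have h5 : ((z : ℂ) - w)⁻¹ - ((z : ℂ) - Complex.I)⁻¹ =
        (w - Complex.I) * (((z : ℂ) - w)⁻¹ * ((z : ℂ) - Complex.I)⁻¹) := by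
      field_simp
      ring
    rw [div_one_add_sq_eq, hft, ← sub_add, h5]
    have h6 : (w - Complex.I) * Complex.I * (((z : ℂ) - w)⁻¹ * (-Complex.I * ((z : ℂ) - Complex.I)⁻¹))
        = -(Complex.I * Complex.I) * ((w - Complex.I) *
          (((z : ℂ) - w)⁻¹ * ((z : ℂ) - Complex.I)⁻¹)) := by ring
    rw [h6, Complex.I_mul_I]
    ring
  simp only [e]
  refine ⟨(h1.const_mul _).add (integrable_inv_one_add_sq_complex.const_mul _), ?_⟩
  rw [integral_add (h1.const_mul _) (integrable_inv_one_add_sq_complex.const_mul _),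
    integral_const_mul, h2, mul_zero, zero_add, integral_const_mul]
  congr 1
  simp only [inv_one_add_sq_eq]
  rw [integral_complex_ofReal, integral_univ_inv_one_add_sq]

variable {p m : ℕ}

/-- The Herglotz representation belonging to a spectral density and finitely many atoms. -/
lemma isHerglotzMeasure_spectralMeasure {d : Fin p → ℝ}
    {κ : Fin p → Fin p → ℝ → ℂ} (hκ : ∀ i j, Integrable (κ i j)) {M : ℝ}
    (hM : ∀ i j s, ‖κ i j s‖ ≤ M)
    (hsymm : ∀ i j z, ft (κ i j) z = conj (ft (κ j i) z))
    (hρm : ∀ i j, Measurable fun z => spectralDensity d κ z i j)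
    (hρ : ∀ z, (spectralDensity d κ z).PosSemidef) (ev : Fin m → ℝ) (a : Fin m → Fin p → ℂ)
    {φ : ℂ → Matrix (Fin p) (Fin p) ℂ}
    (hφ : ∀ w : ℂ, 0 < w.im → ∀ i j, φ w i j = Complex.I / 2 * diagD d i j +
      Complex.I * (∫ s, conj (anticausalExp w s) * κ i j s) +
      ∑ r, ((ev r : ℂ) - w)⁻¹ * Matrix.vecMulVec (a r) (star (a r)) i j) :
    IsHerglotzMeasure φ (spectralMeasure (spectralDensity d κ) hρm hρ ev a) := by
  have hpi := two_pi_ne_zero'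
  -- The matrix ν compensates the counterterms of κ and of the atoms. The D-part needs none: its
  -- full Herglotz integral (2π)⁻¹D·iπ is already the term iD/2 of φ.
  refine ⟨fun i j => ?_, Matrix.of fun i j =>
    (2 * Real.pi : ℂ)⁻¹ * (∫ z : ℝ, (z : ℂ) / (1 + (z : ℂ) ^ 2) * ft (κ i j) z) +
      ∑ r, (ev r : ℂ) / (1 + (ev r : ℂ) ^ 2) * Matrix.vecMulVec (a r) (star (a r)) i j, ?_, ?_⟩
  · refine (integral_spectralMeasure (spectralDensity d κ) hρm hρ ev a
      (fun z => (1 + (z : ℂ) ^ 2)⁻¹ • Matrix.entryLinearMap ℂ ℂ i j) ?_).1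
    have : (fun z : ℝ => ((1 + (z : ℂ) ^ 2)⁻¹ • Matrix.entryLinearMap ℂ ℂ i j)
        (spectralDensity d κ z)) = fun z : ℝ => (2 * Real.pi : ℂ)⁻¹ *
          (diagD d i j * (1 + (z : ℂ) ^ 2)⁻¹ + (1 + (z : ℂ) ^ 2)⁻¹ * ft (κ i j) z) := by
      ext z
      simp only [LinearMap.smul_apply, Matrix.entryLinearMap_apply, spectralDensity,
        Matrix.of_apply, smul_eq_mul]
      ring
    rw [this]
    exact ((integrable_inv_one_add_sq_complex.const_mul _).add
      (integrable_inv_one_add_sq_mul_ft (hκ i j))).const_mul _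
  · ext i j
    rw [Matrix.conjTranspose_apply, Matrix.of_apply, Matrix.of_apply, star_add, star_mul',
      star_sum, Complex.star_def, ← integral_conj]
    congr 1
    · congr 1
      · rw [← Complex.ofReal_ofNat, ← Complex.ofReal_mul, ← Complex.ofReal_inv,
          Complex.conj_ofReal]
      · congr 1
        ext z
        rw [map_mul, ← hsymm i j z]
        congr 1
        simp
    · refine Finset.sum_congr rfl fun r _ => ?_
      simp [Matrix.vecMulVec_apply, mul_comm]
  · intro w hw i j
    obtain ⟨hv1, hv2⟩ := herglotz_integral_volume hw
    obtain ⟨hc1, hc2⟩ := cauchy_integral_ft (hκ i j) (hM i j) hw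
    have hd1 := integrable_div_one_add_sq_mul_ft (hκ i j) (hM i j)
    have e : (fun z : ℝ => ((((z : ℂ) - w)⁻¹ - (z : ℂ) / (1 + (z : ℂ) ^ 2)) •
        Matrix.entryLinearMap ℂ ℂ i j) (spectralDensity d κ z)) = fun z : ℝ =>
        (2 * Real.pi : ℂ)⁻¹ * (diagD d i j * (((z : ℂ) - w)⁻¹ - (z : ℂ) / (1 + (z : ℂ) ^ 2)) +
          (((z : ℂ) - w)⁻¹ * ft (κ i j) z - (z : ℂ) / (1 + (z : ℂ) ^ 2) * ft (κ i j) z)) := by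
      ext z
      simp only [LinearMap.smul_apply, Matrix.entryLinearMap_apply, spectralDensity,
        Matrix.of_apply, smul_eq_mul]
      ring
    have hint : Integrable (fun z : ℝ => ((((z : ℂ) - w)⁻¹ - (z : ℂ) / (1 + (z : ℂ) ^ 2)) •
        Matrix.entryLinearMap ℂ ℂ i j) (spectralDensity d κ z)) := by
      rw [e]
      exact ((hv1.const_mul _).add (hc1.sub hd1)).const_mul _
    have key := (integral_spectralMeasure (spectralDensity d κ) hρm hρ ev a
      (fun z => (((z : ℂ) - w)⁻¹ - (z : ℂ) / (1 + (z : ℂ) ^ 2)) •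
        Matrix.entryLinearMap ℂ ℂ i j) hint).2
    have hcd : Integrable fun z : ℝ => ((z : ℂ) - w)⁻¹ * ft (κ i j) z -
        (z : ℂ) / (1 + (z : ℂ) ^ 2) * ft (κ i j) z := hc1.sub hd1
    rw [e, integral_const_mul, integral_add (hv1.const_mul _) hcd,
      integral_const_mul, hv2, integral_sub hc1 hd1, hc2] at key
    simp only [LinearMap.smul_apply, Matrix.entryLinearMap_apply, smul_eq_mul] at key
    rw [key, hφ w hw, Matrix.of_apply]
    simp only [sub_mul, Finset.sum_sub_distrib]
    have hpi' : (Real.pi : ℂ) ≠ 0 := by exact_mod_cast Real.pi_ne_zero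
    field_simp
    ring

end Herglotz

/-! ### Coercivity on transforms of functions supported in (0,l) -/

section Coercive

variable {p : ℕ}

lemma quadratic_form_factor {d : Fin p → ℝ} (hd : ∀ i, 0 < d i) (G : Matrix (Fin p) (Fin p) ℂ)
    (y : Fin p → ℂ) : star y ⬝ᵥ ((Gᴴ * (diagD d)⁻¹ * G) *ᵥ y) =
      ((∑ i, ‖(G *ᵥ y) i‖ ^ 2 / d i : ℝ) : ℂ) := by
  have := star_dotProduct_dissipation hd Gᴴ y
  rwa [Matrix.conjTranspose_conjTranspose] at this

lemma posSemidef_factor {d : Fin p → ℝ} (hd : ∀ i, 0 < d i) (G : Matrix (Fin p) (Fin p) ℂ) :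
    (Gᴴ * (diagD d)⁻¹ * G).PosSemidef := by
  refine Matrix.PosSemidef.conjTranspose_mul_mul_same ?_ G
  rw [diagD_inv hd]
  refine Matrix.PosSemidef.diagonal fun i => ?_
  rw [← Complex.ofReal_inv]
  exact Complex.zero_le_real.2 (inv_pos.2 (hd i)).le

/-- A weighted square norm of the inverse matrix. -/
def invWeight (d : Fin p → ℝ) (G : Matrix (Fin p) (Fin p) ℂ) : ℝ :=
  ∑ i, ∑ j, d i * ‖G⁻¹ i j‖ ^ 2 * d j

/-- Cauchy–Schwarz applied to y = G⁻¹(Gy), with weights matching the form of G*D⁻¹G on one side and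
the Plancherel weight D on the other. -/
lemma weighted_norm_le {d : Fin p → ℝ} (hd : ∀ i, 0 < d i) {G : Matrix (Fin p) (Fin p) ℂ}
    (hG : G.det ≠ 0) (y : Fin p → ℂ) :
    ∑ i, d i * ‖y i‖ ^ 2 ≤ invWeight d G * ∑ i, ‖(G *ᵥ y) i‖ ^ 2 / d i := by
  rw [invWeight, Finset.sum_mul]
  refine Finset.sum_le_sum fun i _ => ?_
  have hy : y i = ∑ j, G⁻¹ i j * (G *ᵥ y) j := by
    have : G⁻¹ *ᵥ (G *ᵥ y) = y := by
      rw [Matrix.mulVec_mulVec, Matrix.nonsing_inv_mul _ (isUnit_iff_ne_zero.2 hG),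
        Matrix.one_mulVec]
    exact (congrFun this i).symm
  have h1 : ‖y i‖ ≤ ∑ j, (‖G⁻¹ i j‖ * Real.sqrt (d j)) * (‖(G *ᵥ y) j‖ / Real.sqrt (d j)) := by
    rw [hy]
    refine (norm_sum_le _ _).trans (Finset.sum_le_sum fun j _ => ?_)
    have := (Real.sqrt_pos.2 (hd j)).ne'
    rw [norm_mul]
    apply le_of_eq
    field_simp
  have h2 : ‖y i‖ ^ 2 ≤ (∑ j, ‖G⁻¹ i j‖ ^ 2 * d j) * ∑ j, ‖(G *ᵥ y) j‖ ^ 2 / d j := by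
    refine (pow_le_pow_left₀ (norm_nonneg _) h1 2).trans
      ((Finset.sum_mul_sq_le_sq_mul_sq _ _ _).trans (le_of_eq ?_))
    congr 1
    · exact Finset.sum_congr rfl fun j _ => by rw [mul_pow, Real.sq_sqrt (hd j).le]
    · exact Finset.sum_congr rfl fun j _ => by rw [div_pow, Real.sq_sqrt (hd j).le]
  calc d i * ‖y i‖ ^ 2 ≤ d i * ((∑ j, ‖G⁻¹ i j‖ ^ 2 * d j) * ∑ j, ‖(G *ᵥ y) j‖ ^ 2 / d j) :=
        mul_le_mul_of_nonneg_left h2 (hd i).le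
    _ = _ := by
      rw [← mul_assoc, Finset.mul_sum _ (fun j => ‖G⁻¹ i j‖ ^ 2 * d j)]
      simp only [mul_assoc]

lemma measurable_invWeight (d : Fin p → ℝ) {G : ℝ → Matrix (Fin p) (Fin p) ℂ}
    (hG : Continuous G) : Measurable fun z => invWeight d (G z) := by
  unfold invWeight
  refine Finset.measurable_fun_sum _ fun i _ => Finset.measurable_fun_sum _ fun j _ => ?_
  have : Measurable fun z => (G z)⁻¹ i j := by
    -- Writing the inverse as adjugate over determinant gives measurability everywhere, including
    -- singular points, where the inverse is 0 by convention.
    simp only [Matrix.inv_def, Matrix.smul_apply, Ring.inverse_eq_inv', smul_eq_mul]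
    exact hG.matrix_det.measurable.inv.mul (hG.matrix_adjugate.matrix_elem i j).measurable
  exact ((this.norm.pow_const 2).const_mul _).mul_const _

lemma tendsto_invWeight (d : Fin p → ℝ) {G : ℝ → Matrix (Fin p) (Fin p) ℂ}
    {L : Filter ℝ} {G₀ : Matrix (Fin p) (Fin p) ℂ} (hG : Tendsto G L (𝓝 G₀)) (h0 : G₀.det ≠ 0) :
    Tendsto (fun z => invWeight d (G z)) L (𝓝 (invWeight d G₀)) := by
  unfold invWeight
  refine tendsto_finsetSum _ fun i _ => tendsto_finsetSum _ fun j _ => ?_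
  have : Tendsto (fun z => (G z)⁻¹ i j) L (𝓝 (G₀⁻¹ i j)) := by
    simp only [Matrix.inv_def, Matrix.smul_apply, Ring.inverse_eq_inv', smul_eq_mul]
    have h1 : Continuous fun A : Matrix (Fin p) (Fin p) ℂ => A.det := continuous_id.matrix_det
    have h2 : Continuous fun A : Matrix (Fin p) (Fin p) ℂ => A.adjugate i j :=
      continuous_id.matrix_adjugate.matrix_elem i j
    exact (((h1.tendsto _).comp hG).inv₀ h0).mul ((h2.tendsto _).comp hG)
  exact ((this.norm.pow 2).const_mul _).mul_const _

/-- A measurable function with a limit at infinity is bounded off a set of small measure. -/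
lemma exists_measure_lt {q : ℝ → ℝ} (hq : Measurable q) {q₀ : ℝ}
    (hlim : Tendsto q (cocompact ℝ) (𝓝 q₀)) {ε : ENNReal} (hε : 0 < ε) :
    ∃ N : ℕ, 0 < N ∧ volume {z | (N : ℝ) < q z} < ε := by
  obtain ⟨N₀, hN₀⟩ := exists_nat_gt q₀
  have h1 : {z | (N₀ : ℝ) < q z}ᶜ ∈ cocompact ℝ := by
    filter_upwards [hlim.eventually_lt_const hN₀] with z hz
    simpa using hz.le
  obtain ⟨K, hK, hKs⟩ := mem_cocompact.1 h1
  have hfin : volume {z | (N₀ : ℝ) < q z} ≠ ⊤ :=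
    ((measure_mono (Set.compl_subset_compl.1 hKs)).trans_lt hK.measure_lt_top).ne
  have hanti : Antitone fun N : ℕ => {z | (N : ℝ) < q z} := fun a b hab z hz => by
    have : (a : ℝ) ≤ b := by exact_mod_cast hab
    exact lt_of_le_of_lt this hz
  -- The superlevel sets decrease to the empty set, and the one at N₀ has finite measure because it
  -- lies in a compact set; continuity from above applies.
  have h2 := tendsto_measure_iInter_atTop (μ := volume) (s := fun N : ℕ => {z | (N : ℝ) < q z})
    (fun N => (measurableSet_lt measurable_const hq).nullMeasurableSet) hanti ⟨N₀, hfin⟩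
  have h3 : ⋂ N : ℕ, {z | (N : ℝ) < q z} = ∅ := by
    ext z
    simp only [Set.mem_iInter, Set.mem_empty_iff_false, iff_false, not_forall]
    obtain ⟨N, hN⟩ := exists_nat_gt (q z)
    exact ⟨N, fun h => (lt_asymm hN h)⟩
  rw [h3, measure_empty] at h2
  obtain ⟨N, hN, hN'⟩ := ((h2.eventually_lt_const hε).and (eventually_gt_atTop 0)).exists
  exact ⟨N, hN', hN⟩

variable {l : ℝ}

/-- The bounded interval enters here: L² controls L¹, so the transform cannot concentrate on a set
of small measure. -/
lemma exists_norm_transform_le (d : Fin p → ℝ) (l : ℝ) :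
    ∃ c : ℝ, 0 ≤ c ∧ ∀ (f : L2 p l) z i, ‖transform d l f z i‖ ≤ c * ‖f‖ := by
  obtain ⟨c, hc, h⟩ := exists_integral_norm_le p l
  refine ⟨c, hc, fun f z i => le_trans ?_ (h f)⟩
  refine norm_integral_le_of_norm_le (integrable_norm_L2 f) (ae_of_all _ fun x => ?_)
  rw [norm_mul, Complex.norm_exp]
  have : (-(Complex.I * z * x * d i)).re = 0 := by simp
  rw [this, Real.exp_zero, one_mul]
  exact norm_apply_le _ _

lemma integral_norm_transform_sq {d : Fin p → ℝ} (hd : ∀ i, 0 < d i) (f : L2 p l) :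
    Integrable (fun z => ∑ i, d i * ‖transform d l f z i‖ ^ 2) ∧
    ∫ z, ∑ i, d i * ‖transform d l f z i‖ ^ 2 = 2 * Real.pi * ‖f‖ ^ 2 := by
  have h1 := fun i => plancherel_scaled (integrable_comp f i) (memLp_comp f i)
    (integrable_comp f i) (memLp_comp f i) (hd i)
  have e : ∀ z, ((∑ i, d i * ‖transform d l f z i‖ ^ 2 : ℝ) : ℂ) = ∑ i, (d i : ℂ) *
      (conj (ft (comp f i) (d i * z)) * ft (comp f i) (d i * z)) := fun z => by
    push_cast
    simp only [transform_eq_ft, Complex.conj_mul']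
  have hI : Integrable (fun z => ((∑ i, d i * ‖transform d l f z i‖ ^ 2 : ℝ) : ℂ)) := by
    simp only [e]
    exact integrable_finsetSum _ fun i _ => (h1 i).1.const_mul _
  refine ⟨hI.re.congr (ae_of_all _ fun z => Complex.ofReal_re _), ?_⟩
  have h2 : ((∫ z, ∑ i, d i * ‖transform d l f z i‖ ^ 2 : ℝ) : ℂ) =
      ((2 * Real.pi * ‖f‖ ^ 2 : ℝ) : ℂ) := by
    rw [← integral_complex_ofReal]
    simp only [e]
    rw [integral_finsetSum _ fun i _ => (h1 i).1.const_mul _]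
    have h3 : ((2 * Real.pi * ‖f‖ ^ 2 : ℝ) : ℂ) = 2 * Real.pi * inner ℂ f f := by
      rw [inner_self_eq_norm_sq_to_K]
      push_cast
      rfl
    rw [h3, inner_eq_sum, Finset.mul_sum]
    refine Finset.sum_congr rfl fun i _ => ?_
    have hdi : (d i : ℂ) ≠ 0 := Complex.ofReal_ne_zero.2 (hd i).ne'
    rw [integral_const_mul, (h1 i).2, setIntegral_mul_component]
    have h4 : ∀ x, conj (comp f i x) * comp f i x = conj (f x i) * comp f i x := fun x => by
      by_cases hx : x ∈ Set.Ioo (0 : ℝ) l <;> simp [comp, hx]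
    simp only [h4]
    field_simp
  exact_mod_cast h2

/-- A factorized spectral density with generically invertible factor, tending to an invertible
matrix at infinity, is coercive on transforms of functions supported in a bounded interval. -/
lemma exists_coercive {d : Fin p → ℝ} (hd : ∀ i, 0 < d i) (l : ℝ)
    {κ : Fin p → Fin p → ℝ → ℂ} (hκ : ∀ i j, Integrable (κ i j)) {M : ℝ}
    (hM : ∀ i j s, ‖κ i j s‖ ≤ M) {G : ℝ → Matrix (Fin p) (Fin p) ℂ}
    (hG : Continuous G) {G₀ : Matrix (Fin p) (Fin p) ℂ} (hlim : Tendsto G (cocompact ℝ) (𝓝 G₀))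
    (h0 : G₀.det ≠ 0) (hfin : {z | (G z).det = 0}.Finite)
    (hfac : ∀ z, spectralDensity d κ z =
      (2 * Real.pi : ℂ)⁻¹ • ((G z)ᴴ * (diagD d)⁻¹ * G z)) :
    ∃ c : ℝ, 0 < c ∧ ∀ f : L2 p l, ∃ r : ℝ,
      ∫ z, star (transform d l f z) ⬝ᵥ (spectralDensity d κ z *ᵥ transform d l f z) = r ∧
        c * ‖f‖ ^ 2 ≤ r := by
  obtain ⟨c, hc, hcf⟩ := exists_norm_transform_le d l
  set B : ℝ := ∑ i, d i * c ^ 2 with hB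
  have hB0 : 0 ≤ B := Finset.sum_nonneg fun i _ => mul_nonneg (hd i).le (sq_nonneg _)
  -- With |E| < π/(B + 1) the exceptional set carries at most π‖f‖², half of the total 2π‖f‖²; the
  -- added 1 covers B = 0.
  obtain ⟨N, hN, hNvol⟩ := exists_measure_lt (measurable_invWeight d hG)
    (tendsto_invWeight d hlim h0) (ε := ENNReal.ofReal (Real.pi / (B + 1)))
    (ENNReal.ofReal_pos.2 (div_pos Real.pi_pos (by positivity)))
  set E := {z | (N : ℝ) < invWeight d (G z)} with hE
  have hEm : MeasurableSet E := measurableSet_lt measurable_const (measurable_invWeight d hG)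
  have hEfin : volume E ≠ ⊤ := (hNvol.trans ENNReal.ofReal_lt_top).ne
  have hEB : volume.real E * B ≤ Real.pi := by
    have h1 : volume.real E ≤ Real.pi / (B + 1) :=
      ENNReal.toReal_le_of_le_ofReal (by positivity) hNvol.le
    have h2 : volume.real E * (B + 1) ≤ Real.pi := by rwa [le_div_iff₀ (by positivity)] at h1
    nlinarith [measureReal_nonneg (μ := volume) (s := E)]
  have hN' : (0 : ℝ) < N := by exact_mod_cast hN
  -- Outside E the factor costs at most N, so N∫R ≥ 2π‖f‖² - π‖f‖²; the prefactor (2π)⁻¹ of the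
  -- density leaves 1/(2N).
  refine ⟨(2 * N : ℝ)⁻¹, by positivity, fun f => ?_⟩
  have hint := (integral_spectralDensity hd hκ hM f f).1
  set R : ℝ → ℝ := fun z => ∑ i, ‖(G z *ᵥ transform d l f z) i‖ ^ 2 / d i with hR
  have hR0 : ∀ z, 0 ≤ R z := fun z =>
    Finset.sum_nonneg fun i _ => div_nonneg (sq_nonneg _) (hd i).le
  have hRe : ∀ z, star (transform d l f z) ⬝ᵥ (spectralDensity d κ z *ᵥ transform d l f z) =
      (((2 * Real.pi)⁻¹ * R z : ℝ) : ℂ) := fun z => by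
    rw [hfac, Matrix.smul_mulVec, dotProduct_smul, quadratic_form_factor hd, smul_eq_mul]
    simp [hR]
  simp only [hRe] at hint ⊢
  refine ⟨_, integral_complex_ofReal, ?_⟩
  rw [integral_const_mul]
  have hRint : Integrable R := by
    have h1 : Integrable fun z => (2 * Real.pi)⁻¹ * R z :=
      hint.re.congr (ae_of_all _ fun z => Complex.ofReal_re _)
    have h2 := h1.const_mul (2 * Real.pi)
    refine h2.congr (ae_of_all _ fun z => ?_)
    exact mul_inv_cancel_left₀ (by positivity) _
  obtain ⟨hT1, hT2⟩ := integral_norm_transform_sq hd f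
  -- On E the uniform bound on the transform is used, off E the bound on G⁻¹. The finitely many
  -- singular points must be discarded, as the inverse there carries no information.
  have hpt : ∀ᵐ z, ∑ i, d i * ‖transform d l f z i‖ ^ 2 ≤
      N * R z + E.indicator (fun _ => B * ‖f‖ ^ 2) z := by
    have : ∀ᵐ z : ℝ, z ∉ {z | (G z).det = 0} := hfin.countable.ae_notMem _
    filter_upwards [this] with z hz
    by_cases hzE : z ∈ E
    · rw [Set.indicator_of_mem hzE]
      have h1 : ∑ i, d i * ‖transform d l f z i‖ ^ 2 ≤ B * ‖f‖ ^ 2 := by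
        rw [hB, Finset.sum_mul]
        refine Finset.sum_le_sum fun i _ => ?_
        rw [mul_assoc, ← mul_pow]
        exact mul_le_mul_of_nonneg_left
          (pow_le_pow_left₀ (norm_nonneg _) (hcf f z i) 2) (hd i).le
      have := mul_nonneg hN'.le (hR0 z)
      linarith
    · rw [Set.indicator_of_notMem hzE, add_zero]
      refine (weighted_norm_le hd hz _).trans (mul_le_mul_of_nonneg_right ?_ (hR0 z))
      exact not_lt.1 hzE
  have hind : Integrable (E.indicator fun _ : ℝ => B * ‖f‖ ^ 2) :=
    (integrable_indicator_iff hEm).2 (integrableOn_const hEfin)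
  have hle := integral_mono_ae hT1 ((hRint.const_mul (N : ℝ)).add hind) hpt
  simp only [Pi.add_apply] at hle
  rw [hT2, integral_add (hRint.const_mul _) hind, integral_const_mul,
    integral_indicator_const _ hEm, smul_eq_mul, ← mul_assoc] at hle
  have h5 : volume.real E * B * ‖f‖ ^ 2 ≤ Real.pi * ‖f‖ ^ 2 :=
    mul_le_mul_of_nonneg_right hEB (sq_nonneg _)
  have h6 : Real.pi * ‖f‖ ^ 2 ≤ N * ∫ z, R z := by linarith
  have hpi := Real.pi_pos
  calc (2 * N : ℝ)⁻¹ * ‖f‖ ^ 2 = (2 * Real.pi)⁻¹ * ((N : ℝ)⁻¹ * (Real.pi * ‖f‖ ^ 2)) := by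
        field_simp
    _ ≤ (2 * Real.pi)⁻¹ * ((N : ℝ)⁻¹ * (N * ∫ z, R z)) := by gcongr
    _ = _ := by rw [inv_mul_cancel_left₀ hN'.ne']

end Coercive

/-! ### The decaying hermitian kernel and its transforms -/

section CausalKernel

variable {n p : ℕ}

/-- The entries of `X^* e^{sC} Y`, cut off to `s > 0`. -/
def causalKernel (C : Matrix (Fin n) (Fin n) ℂ) (X Y : Matrix (Fin n) (Fin p) ℂ)
    (i j : Fin p) (s : ℝ) : ℂ :=
  ∑ b, ∑ c, conj (X b i) * Y c j * causalExp C b c s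

lemma sandwich_apply (X Y : Matrix (Fin n) (Fin p) ℂ) (J : Matrix (Fin n) (Fin n) ℂ)
    (i j : Fin p) : (Xᴴ * J * Y) i j = ∑ b, ∑ c, conj (X b i) * Y c j * J b c := by
  simp only [Matrix.mul_apply, Finset.sum_mul, Matrix.conjTranspose_apply]
  rw [Finset.sum_comm]
  refine Finset.sum_congr rfl fun b _ => Finset.sum_congr rfl fun c _ => ?_
  rw [Complex.star_def]
  ring

lemma causalKernel_of_pos (C : Matrix (Fin n) (Fin n) ℂ) (X Y : Matrix (Fin n) (Fin p) ℂ)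
    (i j : Fin p) {s : ℝ} (hs : 0 < s) :
    causalKernel C X Y i j s = (Xᴴ * NormedSpace.exp ((s : ℂ) • C) * Y) i j := by
  simp only [causalKernel, causalExp, hs, if_true, sandwich_apply]

lemma causalKernel_of_nonpos (C : Matrix (Fin n) (Fin n) ℂ) (X Y : Matrix (Fin n) (Fin p) ℂ)
    (i j : Fin p) {s : ℝ} (hs : s ≤ 0) : causalKernel C X Y i j s = 0 := by
  simp [causalKernel, causalExp, not_lt.2 hs]

variable {C : Matrix (Fin n) (Fin n) ℂ}

lemma measurable_causalKernel (X Y : Matrix (Fin n) (Fin p) ℂ) (i j : Fin p) :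
    Measurable (causalKernel C X Y i j) :=
  Finset.measurable_fun_sum _ fun b _ => Finset.measurable_fun_sum _ fun c _ =>
    (measurable_causalExp b c).const_mul _

lemma integrable_causalKernel (hC : IsStable C) (X Y : Matrix (Fin n) (Fin p) ℂ) (i j : Fin p) :
    Integrable (causalKernel C X Y i j) :=
  integrable_finsetSum _ fun b _ => integrable_finsetSum _ fun c _ =>
    (integrable_causalExp hC b c).const_mul _

lemma exists_bound_causalKernel (hC : IsStable C) (X Y : Matrix (Fin n) (Fin p) ℂ) :
    ∃ M : ℝ, ∀ i j s, ‖causalKernel C X Y i j s‖ ≤ M := by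
  obtain ⟨M, hM⟩ := exists_bound_causalExp hC
  have h : ∀ i j, ∃ N : ℝ, ∀ s, ‖causalKernel C X Y i j s‖ ≤ N := fun i j =>
    ⟨∑ b, ∑ c, ‖conj (X b i) * Y c j‖ * M, fun s =>
      (norm_sum_le _ _).trans (Finset.sum_le_sum fun b _ =>
        (norm_sum_le _ _).trans (Finset.sum_le_sum fun c _ => by
          rw [norm_mul]
          exact mul_le_mul_of_nonneg_left (hM b c s) (norm_nonneg _)))⟩
  choose N hN using h
  refine ⟨∑ i, ∑ j, |N i j|, fun i j s => (hN i j s).trans ((le_abs_self _).trans ?_)⟩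
  exact (Finset.single_le_sum (f := fun j => |N i j|) (fun _ _ => abs_nonneg _)
    (Finset.mem_univ j)).trans (Finset.single_le_sum (f := fun i => ∑ j, |N i j|)
      (fun _ _ => Finset.sum_nonneg fun _ _ => abs_nonneg _) (Finset.mem_univ i))

lemma laplace_causalKernel (hC : IsStable C) (X Y : Matrix (Fin n) (Fin p) ℂ) (i j : Fin p)
    {ζ : ℂ} (hζ : ζ.re ≤ 0) :
    ∫ s : ℝ, Complex.exp (ζ * s) * causalKernel C X Y i j s =
      (Xᴴ * ((-ζ) • 1 - C)⁻¹ * Y) i j := by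
  have h := fun b c => laplace_causalExp hC hζ b c
  rw [sandwich_apply]
  have e : ∀ s : ℝ, Complex.exp (ζ * s) * causalKernel C X Y i j s =
      ∑ b, ∑ c, conj (X b i) * Y c j * (Complex.exp (ζ * s) * causalExp C b c s) := fun s => by
    simp only [causalKernel, Finset.mul_sum]
    exact Finset.sum_congr rfl fun b _ => Finset.sum_congr rfl fun c _ => by ring
  simp only [e]
  rw [integral_finsetSum _ fun b _ => integrable_finsetSum _ fun c _ => (h b c).1.const_mul _]
  refine Finset.sum_congr rfl fun b _ => ?_
  rw [integral_finsetSum _ fun c _ => (h b c).1.const_mul _]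
  refine Finset.sum_congr rfl fun c _ => ?_
  rw [integral_const_mul, (h b c).2]

lemma ft_causalKernel (hC : IsStable C) (X Y : Matrix (Fin n) (Fin p) ℂ) (i j : Fin p) (z : ℝ) :
    ft (causalKernel C X Y i j) z = (Xᴴ * ((Complex.I * z) • 1 - C)⁻¹ * Y) i j := by
  have := laplace_causalKernel hC X Y i j (ζ := -(Complex.I * z)) (by simp)
  rw [neg_neg] at this
  rw [← this, ft]
  simp only [neg_mul]

/-- The hermitian kernel `κ(s) = X^* e^{sC} Y` for `s > 0`, `κ(-s) = κ(s)^*`. -/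
def hermitianKernel (C : Matrix (Fin n) (Fin n) ℂ) (X Y : Matrix (Fin n) (Fin p) ℂ)
    (i j : Fin p) (s : ℝ) : ℂ :=
  causalKernel C X Y i j s + conj (causalKernel C X Y j i (-s))

lemma integrable_conj_comp_neg {u : ℝ → ℂ} (hu : Integrable u) :
    Integrable fun s => conj (u (-s)) :=
  memLp_one_iff_integrable.1 (memLp_one_iff_integrable.2 hu.comp_neg).star

lemma ft_conj_comp_neg (u : ℝ → ℂ) (z : ℝ) : ft (fun s => conj (u (-s))) z = conj (ft u z) := by
  rw [ft, ft, ← integral_conj, ← integral_neg_eq_self]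
  congr 1
  ext s
  rw [map_mul, ← Complex.exp_conj, neg_neg]
  congr 2
  simp

lemma integrable_hermitianKernel (hC : IsStable C) (X Y : Matrix (Fin n) (Fin p) ℂ)
    (i j : Fin p) : Integrable (hermitianKernel C X Y i j) :=
  (integrable_causalKernel hC X Y i j).add
    (integrable_conj_comp_neg (integrable_causalKernel hC X Y j i))

lemma measurable_hermitianKernel (X Y : Matrix (Fin n) (Fin p) ℂ) (i j : Fin p) :
    Measurable (hermitianKernel C X Y i j) :=
  (measurable_causalKernel X Y i j).add
    (Complex.continuous_conj.measurable.comp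
      ((measurable_causalKernel X Y j i).comp measurable_neg))

lemma exists_bound_hermitianKernel (hC : IsStable C) (X Y : Matrix (Fin n) (Fin p) ℂ) :
    ∃ M : ℝ, ∀ i j s, ‖hermitianKernel C X Y i j s‖ ≤ M := by
  obtain ⟨M, hM⟩ := exists_bound_causalKernel hC X Y
  refine ⟨M + M, fun i j s => (norm_add_le _ _).trans (add_le_add (hM i j s) ?_)⟩
  rw [RCLike.norm_conj]
  exact hM j i (-s)

lemma ft_hermitianKernel (hC : IsStable C) (X Y : Matrix (Fin n) (Fin p) ℂ) (i j : Fin p)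
    (z : ℝ) : ft (hermitianKernel C X Y i j) z =
      (Xᴴ * ((Complex.I * z) • 1 - C)⁻¹ * Y) i j +
        conj ((Xᴴ * ((Complex.I * z) • 1 - C)⁻¹ * Y) j i) := by
  rw [← ft_causalKernel hC, ← ft_causalKernel hC, ← ft_conj_comp_neg]
  have hb : ∀ (u : ℝ → ℂ), Integrable u →
      Integrable fun s : ℝ => Complex.exp (-(Complex.I * z * s)) * u s := fun u hu =>
    hu.bdd_mul (c := 1) (by fun_prop) (ae_of_all _ fun s => (norm_exp_neg_I z s).le)
  rw [ft, ft, ft, ← integral_add (hb _ (integrable_causalKernel hC X Y i j))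
    (hb _ (integrable_conj_comp_neg (integrable_causalKernel hC X Y j i)))]
  congr 1
  ext s
  rw [hermitianKernel, mul_add]

/-- The factor supported on s ≤ 0 removes the causal half of the kernel; after s ↦ -s the other half
is the conjugate of a Laplace transform, that is, of a resolvent of C. -/
lemma cauchy_hermitianKernel (hC : IsStable C) (X Y : Matrix (Fin n) (Fin p) ℂ) (i j : Fin p)
    {w : ℂ} (hw : 0 < w.im) :
    ∫ s, conj (anticausalExp w s) * hermitianKernel C X Y i j s =
      (Xᴴ * ((Complex.I * conj w) • 1 - C)⁻¹ * Y)ᴴ i j := by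
  have h := laplace_causalKernel hC X Y j i (ζ := -(Complex.I * conj w)) (by simpa using hw.le)
  rw [neg_neg] at h
  rw [Matrix.conjTranspose_apply, ← h, Complex.star_def, ← integral_conj, ← integral_neg_eq_self]
  congr 1
  ext s
  rw [hermitianKernel, neg_neg]
  rcases le_or_gt s 0 with hs | hs
  · rw [causalKernel_of_nonpos C X Y j i hs, map_zero, add_zero, mul_zero, map_zero]
    rcases hs.eq_or_lt with rfl | hs
    · rw [causalKernel_of_nonpos _ _ _ _ _ (by simp), mul_zero]
    · have : ¬ -s ≤ 0 := by linarith
      simp [anticausalExp, this]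
  · rw [causalKernel_of_nonpos C X Y i j (by linarith : -s ≤ 0), zero_add, map_mul]
    congr 2
    have : -s ≤ 0 := by linarith
    simp only [anticausalExp, this, if_true]
    congr 1
    push_cast
    ring

end CausalKernel

/-! ### Existence of the operator with a given D-difference kernel -/

section Main

variable {p : ℕ} {l : ℝ}

/-- For fixed x the arguments d_i x - d_j t vanish only for finitely many t, so the value of the
kernel at 0 is irrelevant. -/
lemma IsDDifferenceOperator.congr {d : Fin p → ℝ} (hd : ∀ i, 0 < d i)
    {k k' : ℝ → Matrix (Fin p) (Fin p) ℂ} (h : ∀ s, s ≠ 0 → ∀ i j, k s i j = k' s i j)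
    {S : L2 p l →L[ℂ] L2 p l} (hS : IsDDifferenceOperator d l k' S) :
    IsDDifferenceOperator d l k S := by
  intro f
  filter_upwards [hS f] with x hx i
  rw [hx i]
  congr 1
  refine integral_congr_ae ?_
  have : ∀ j, ∀ᵐ t ∂(volume.restrict (Set.Ioo (0 : ℝ) l)), t ≠ (d j)⁻¹ * (d i * x) :=
    fun j => Measure.ae_ne _ _
  filter_upwards [ae_all_iff.2 this] with t ht
  refine Finset.sum_congr rfl fun j _ => ?_
  rw [h]
  intro h0
  refine ht j ?_
  rw [eq_inv_mul_iff_mul_eq₀ (hd j).ne']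
  linarith

lemma exists_dDifferenceOperator (d : Fin p → ℝ) {k : ℝ → Matrix (Fin p) (Fin p) ℂ}
    (hk : ∀ i j, Measurable fun s => k s i j) {M : ℝ} (hM : ∀ i j s, ‖k s i j‖ ≤ M) :
    ∃ S : L2 p l →L[ℂ] L2 p l, IsDDifferenceOperator d l k S := by
  obtain ⟨T, hT⟩ := exists_integralOperator (l := l)
    (fun i j x t => k (d i * x - d j * t) i j)
    (fun i j => (hk i j).comp (by fun_prop : Measurable fun q : ℝ × ℝ => d i * q.1 - d j * q.2))
    (fun i j x t => hM i j _)
  refine ⟨1 + T, fun f => ?_⟩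
  filter_upwards [hT f, Lp.coeFn_add f (T f)] with x hx hadd i
  have : (1 + T) f = f + T f := rfl
  rw [this, hadd, Pi.add_apply, PiLp.add_apply, hx i]

/-- Sesquilinear evaluation of a matrix as a linear functional. -/
def sesqForm (y x : Fin p → ℂ) : Matrix (Fin p) (Fin p) ℂ →ₗ[ℂ] ℂ where
  toFun A := star y ⬝ᵥ (A *ᵥ x)
  map_add' A B := by rw [Matrix.add_mulVec, dotProduct_add]
  map_smul' c A := by rw [Matrix.smul_mulVec, dotProduct_smul]; rfl

end Main

/-! ### The positive operator and its spectral representation -/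

section Main

variable {n p : ℕ} {l : ℝ}

/-- For s < 0 the adjoint of the trigonometric sum at -s is the same sum at s, as the matrices a a*
are hermitian and the frequencies real. -/
lemma kernel_eq {β : Matrix (Fin n) (Fin n) ℂ} {Θ₁ Θ₂ : Matrix (Fin n) (Fin p) ℂ} {m : ℕ}
    {ev : Fin m → ℝ} {a : Fin m → Fin p → ℂ} {C : Matrix (Fin n) (Fin n) ℂ}
    {X₁ X₂ : Matrix (Fin n) (Fin p) ℂ}
    (hexp : ∀ s : ℝ, Θ₂ᴴ * NormedSpace.exp ((Complex.I * (s : ℂ)) • βᴴ) * Θ₁ =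
        X₂ᴴ * NormedSpace.exp ((s : ℂ) • C) * X₁ +
          ∑ k, Complex.exp (Complex.I * s * ev k) • Matrix.vecMulVec (a k) (star (a k)))
    {s : ℝ} (hs : s ≠ 0) (i j : Fin p) :
    kernel β Θ₁ Θ₂ s i j = hermitianKernel C X₂ X₁ i j s +
      ∑ r, Complex.exp (Complex.I * s * ev r) * Matrix.vecMulVec (a r) (star (a r)) i j := by
  rcases lt_or_gt_of_ne hs with h | h
  · rw [kernel, if_neg (not_lt.2 h.le), hexp, hermitianKernel,
      causalKernel_of_nonpos _ _ _ _ _ h.le, zero_add,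
      causalKernel_of_pos _ _ _ _ _ (neg_pos.2 h), Matrix.conjTranspose_apply, Matrix.add_apply,
      star_add, Matrix.sum_apply, star_sum]
    congr 1
    refine Finset.sum_congr rfl fun r _ => ?_
    rw [Matrix.smul_apply, smul_eq_mul, star_mul', Complex.star_def, ← Complex.exp_conj]
    congr 1
    · congr 1
      simp
    · simp [Matrix.vecMulVec_apply, mul_comm]
  · rw [kernel, if_pos h, hexp, hermitianKernel, causalKernel_of_pos _ _ _ _ _ h,
      causalKernel_of_nonpos _ _ _ _ _ (neg_nonpos.2 h.le), map_zero, add_zero,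
      Matrix.add_apply, Matrix.sum_apply]
    rfl

/-- The spectral density of a stable realization factors through a continuous matrix function
that tends to `D` at infinity and is invertible off a finite set. -/
lemma exists_density_factor {d : Fin p → ℝ} (hd : ∀ i, 0 < d i) {C : Matrix (Fin n) (Fin n) ℂ}
    (hC : IsStable C) {X₁ X₂ : Matrix (Fin n) (Fin p) ℂ}
    (hfac : ∀ z : ℝ, diagD d + X₂ᴴ * ((Complex.I * z) • 1 - C)⁻¹ * X₁ +
          (X₂ᴴ * ((Complex.I * z) • 1 - C)⁻¹ * X₁)ᴴ =
        (diagD d - (X₂ᴴ * ((Complex.I * z) • 1 - C)⁻¹ * (X₂ - X₁))ᴴ)ᴴ * (diagD d)⁻¹ *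
          (diagD d - (X₂ᴴ * ((Complex.I * z) • 1 - C)⁻¹ * (X₂ - X₁))ᴴ)) :
    ∃ G : ℝ → Matrix (Fin p) (Fin p) ℂ, Continuous G ∧
      Tendsto G (cocompact ℝ) (𝓝 (diagD d)) ∧ {z | (G z).det = 0}.Finite ∧
      ∀ z, spectralDensity d (hermitianKernel C X₂ X₁) z =
        (2 * Real.pi : ℂ)⁻¹ • ((G z)ᴴ * (diagD d)⁻¹ * G z) := by
  set G : ℝ → Matrix (Fin p) (Fin p) ℂ := fun z =>
    diagD d - (X₂ᴴ * ((Complex.I * z) • 1 - C)⁻¹ * (X₂ - X₁))ᴴ with hG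
  have hGij : ∀ z i j, G z i j =
      diagD d i j - conj (ft (causalKernel C X₂ (X₂ - X₁) j i) z) := fun z i j => by
    rw [hG, ft_causalKernel hC]
    rfl
  have hDu : diagD d * (diagD d)⁻¹ = 1 := by
    refine Matrix.mul_nonsing_inv _ (isUnit_iff_ne_zero.2 ?_)
    rw [diagD, Matrix.det_diagonal]
    exact Finset.prod_ne_zero_iff.2 fun i _ => Complex.ofReal_ne_zero.2 (hd i).ne'
  refine ⟨G, ?_, ?_, finite_det_eq_zero hDu X₂ (X₂ - X₁) hC, fun z => ?_⟩
  · refine continuous_matrix fun i j => ?_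
    simp only [hGij]
    exact continuous_const.sub
      (Complex.continuous_conj.comp (continuous_ft (integrable_causalKernel hC _ _ j i)))
  · refine tendsto_pi_nhds.2 fun i => tendsto_pi_nhds.2 fun j => ?_
    simp only [hGij]
    have h := (Complex.continuous_conj.tendsto 0).comp
      (tendsto_ft (causalKernel C X₂ (X₂ - X₁) j i))
    rw [map_zero] at h
    simpa using (tendsto_const_nhds (x := diagD d i j)).sub h
  · rw [hG, ← hfac z]
    ext i j
    rw [spectralDensity, Matrix.of_apply, ft_hermitianKernel hC, Matrix.smul_apply, smul_eq_mul,
      Matrix.add_apply, Matrix.add_apply, Matrix.conjTranspose_apply, Complex.star_def, add_assoc]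

/-- The operator with a hermitian `D`-difference kernel has a positive spectral representation. -/
theorem exists_positive_dDifferenceOperator {d : Fin p → ℝ} (hd : ∀ i, 0 < d i)
    (β : Matrix (Fin n) (Fin n) ℂ) (Θ₁ Θ₂ : Matrix (Fin n) (Fin p) ℂ)
    (hβ : βᴴ - β = Complex.I • ((Θ₂ - Θ₁) * (diagD d)⁻¹ * (Θ₂ - Θ₁)ᴴ)) :
    ∃ S : L2 p l →L[ℂ] L2 p l,
      IsDDifferenceOperator d l (kernel β Θ₁ Θ₂) S ∧
      (∃ c : ℝ, 0 < c ∧ ∀ f : L2 p l, ∃ r : ℝ, inner ℂ f (S f) = r ∧ c * ‖f‖ ^ 2 ≤ r) ∧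
      ∃ τ : MatrixMeasure p, IsHerglotzMeasure (phi d β Θ₁ Θ₂) τ ∧
        IsSpectralIntegral d l τ S := by
  obtain ⟨m, ev, a, C, X₁, X₂, hC, hexp, hres, hfac⟩ := exists_stable_realization hd β Θ₁ Θ₂ hβ
  obtain ⟨G, hGc, hGlim, hGdet, hGfac⟩ := exists_density_factor hd hC hfac
  set κ := hermitianKernel C X₂ X₁ with hκdef
  have hκ := integrable_hermitianKernel hC X₂ X₁
  have hκm := measurable_hermitianKernel (C := C) X₂ X₁
  obtain ⟨M, hM⟩ := exists_bound_hermitianKernel hC X₂ X₁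
  have hk := fun s (hs : s ≠ 0) i j => kernel_eq (β := β) hexp hs i j
  obtain ⟨S, hS⟩ : ∃ S : L2 p l →L[ℂ] L2 p l,
      IsDDifferenceOperator d l (kernel β Θ₁ Θ₂) S := by
    obtain ⟨N, hN⟩ : ∃ N : ℝ, ∀ i j, ∑ r, ‖Matrix.vecMulVec (a r) (star (a r)) i j‖ ≤ N := by
      refine ⟨∑ i, ∑ j, ∑ r, ‖Matrix.vecMulVec (a r) (star (a r)) i j‖, fun i j => ?_⟩
      have h0 : ∀ i j, 0 ≤ ∑ r, ‖Matrix.vecMulVec (a r) (star (a r)) i j‖ :=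
        fun i j => Finset.sum_nonneg fun _ _ => norm_nonneg _
      exact (Finset.single_le_sum
        (f := fun j => ∑ r, ‖Matrix.vecMulVec (a r) (star (a r)) i j‖)
        (fun j _ => h0 i j) (Finset.mem_univ j)).trans (Finset.single_le_sum
        (f := fun i => ∑ j, ∑ r, ‖Matrix.vecMulVec (a r) (star (a r)) i j‖)
        (fun i _ => Finset.sum_nonneg fun j _ => h0 i j) (Finset.mem_univ i))
    -- Measurability and boundedness are read off from the split form of the kernel; it agrees with
    -- the original one away from s = 0.
    refine (exists_dDifferenceOperator (l := l) d
      (k := fun s => Matrix.of fun i j => κ i j s +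
        ∑ r, Complex.exp (Complex.I * s * ev r) * Matrix.vecMulVec (a r) (star (a r)) i j)
      (M := M + N) (fun i j => ?_) (fun i j s => ?_)).imp fun S hS => hS.congr hd hk
    · simp only [Matrix.of_apply]
      refine (hκm i j).add (Finset.measurable_fun_sum _ fun r _ => ?_)
      exact Measurable.mul_const (by fun_prop) _
    · rw [Matrix.of_apply]
      refine (norm_add_le _ _).trans (add_le_add (hM i j s) ((norm_sum_le _ _).trans
        (le_trans (le_of_eq (Finset.sum_congr rfl fun r _ => ?_)) (hN i j))))
      rw [norm_mul, Complex.norm_exp]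
      simp
  have hinner := inner_eq_spectral hd hκ hκm hM ev a hk hS
  have hρm : ∀ i j, Measurable fun z => spectralDensity d κ z i j := fun i j =>
    ((continuous_ft (hκ i j)).measurable.const_add _).const_mul _
  have hρ : ∀ z, (spectralDensity d κ z).PosSemidef := fun z => by
    rw [hGfac]
    have : (0 : ℂ) ≤ (2 * Real.pi : ℂ)⁻¹ := by
      rw [← Complex.ofReal_ofNat, ← Complex.ofReal_mul, ← Complex.ofReal_inv]
      exact Complex.zero_le_real.2 (by positivity)
    exact (posSemidef_factor hd (G z)).smul this
  obtain ⟨c, hc, hcoer⟩ := exists_coercive hd l hκ hM hGc hGlim (by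
    rw [diagD, Matrix.det_diagonal]
    exact Finset.prod_ne_zero_iff.2 fun i _ => Complex.ofReal_ne_zero.2 (hd i).ne') hGdet hGfac
  refine ⟨S, hS, ⟨c, hc, fun f => ?_⟩, spectralMeasure (spectralDensity d κ) hρm hρ ev a,
    isHerglotzMeasure_spectralMeasure hκ hM (fun i j z => ?_) hρm hρ ev a (fun w hw i j => ?_),
    fun f g => ?_⟩
  · obtain ⟨r, hr, hcr⟩ := hcoer f
    -- The atoms contribute nonnegatively, so the coercivity constant of the absolutely continuous
    -- part survives.
    have hatom : 0 ≤ ∑ r, star (transform d l f (ev r)) ⬝ᵥ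
        (Matrix.vecMulVec (a r) (star (a r)) *ᵥ transform d l f (ev r)) :=
      Finset.sum_nonneg fun r _ =>
        (Matrix.posSemidef_vecMulVec_self_star (a r)).dotProduct_mulVec_nonneg _
    obtain ⟨t, ht, hte⟩ : ∃ t : ℝ, 0 ≤ t ∧ ∑ r, star (transform d l f (ev r)) ⬝ᵥ
        (Matrix.vecMulVec (a r) (star (a r)) *ᵥ transform d l f (ev r)) = t :=
      ⟨_, (Complex.le_def.1 hatom).1, Complex.ext rfl (Complex.le_def.1 hatom).2.symm⟩
    refine ⟨r + t, ?_, by linarith⟩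
    rw [hinner, hr, hte, Complex.ofReal_add]
  · rw [ft_hermitianKernel hC, ft_hermitianKernel hC, map_add, Complex.conj_conj, add_comm]
  · rw [phi, Matrix.add_apply, hres w hw, Matrix.add_apply, Matrix.smul_apply, Matrix.smul_apply,
      smul_eq_mul, smul_eq_mul, cauchy_hermitianKernel hC X₂ X₁ i j hw, Matrix.sum_apply,
      add_assoc]
    rfl
  · have key := integral_spectralMeasure (spectralDensity d κ) hρm hρ ev a
      (fun z => sesqForm (transform d l g z) (transform d l f z))
      (integral_spectralDensity hd hκ hM g f).1
    exact ⟨key.1, (hinner g f).trans key.2.symm⟩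

end Main

end DDifference

end

theorem mainTheorem4 {n p : ℕ} (d : Fin p → ℝ) (hd : ∀ i, 0 < d i) (l : ℝ) (hl : 0 < l)
    (β : Matrix (Fin n) (Fin n) ℂ) (Θ₁ Θ₂ : Matrix (Fin n) (Fin p) ℂ)
    (hβ : βᴴ - β = Complex.I • ((Θ₂ - Θ₁) * (DDifference.diagD d)⁻¹ * (Θ₂ - Θ₁)ᴴ)) :
    ∃ S : DDifference.L2 p l →L[ℂ] DDifference.L2 p l,
      DDifference.IsDDifferenceOperator d l (DDifference.kernel β Θ₁ Θ₂) S ∧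
      S.IsPositive ∧
      (∀ f : DDifference.L2 p l, f ≠ 0 → 0 < RCLike.re (inner ℂ (S f) f)) ∧
      IsUnit S ∧
      ∃ τ : DDifference.MatrixMeasure p,
        DDifference.IsHerglotzMeasure (DDifference.phi d β Θ₁ Θ₂) τ ∧
        DDifference.IsSpectralIntegral d l τ S := by
  obtain ⟨S, hS, ⟨c, hc, hcoer⟩, hτ⟩ :=
    DDifference.exists_positive_dDifferenceOperator (l := l) hd β Θ₁ Θ₂ hβ
  have hreal : ∀ f, ∃ r : ℝ, inner ℂ (S f) f = r ∧ c * ‖f‖ ^ 2 ≤ r := fun f => by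
    obtain ⟨r, hr, hcr⟩ := hcoer f
    refine ⟨r, ?_, hcr⟩
    rw [← inner_conj_symm, hr]
    exact Complex.conj_ofReal r
  refine ⟨S, hS, ?_, fun f hf => ?_, ?_, hτ⟩
  -- Over ℂ a real nonnegative quadratic form already implies self-adjointness.
  · rw [ContinuousLinearMap.isPositive_iff_complex]
    intro f
    obtain ⟨r, hr, hcr⟩ := hreal f
    rw [hr]
    exact ⟨rfl, (mul_nonneg hc.le (sq_nonneg _)).trans hcr⟩
  · obtain ⟨r, hr, hcr⟩ := hreal f
    rw [hr]
    exact (mul_pos hc (pow_pos (norm_pos_iff.2 hf) 2)).trans_le hcr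
  -- Lax–Milgram: the lower bound on the form gives a bounded inverse.
  · refine ContinuousLinearMap.isUnit_of_forall_le_norm_inner_map S (c := ⟨c, hc.le⟩) hc fun f => ?_
    obtain ⟨r, hr, hcr⟩ := hreal f
    rw [hr, Complex.norm_real]
    calc ‖f‖ ^ 2 * c = c * ‖f‖ ^ 2 := mul_comm _ _
      _ ≤ r := hcr
      _ ≤ ‖r‖ := le_abs_self r
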